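/- Let $N\ge 3$. Let $V:(0,\infty)\to[0,\infty)$ and $K:(0,\infty)\to(0,\infty)$ be continuous, and assume that there is $C>0$ with $V(r)\le C/r^2$ for all $r\in(0,1)$. Let $f:\mathbb R\to\mathbb R$ be the unique solution of $f'(t)=\frac{1}{\sqrt{1+2f(t)^2}}$ on $\mathbb R$, $f(0)=0$. Let $D^{1,2}_r(\mathbb R^N)$ be the closure of the space of radial functions in $C_c^\infty(\mathbb R^N)$ with respect to the norm $\|u\|_{1,2}=\left(\int_{\mathbb R^N}|\nabla u|^2\,dx\right)^{1/2}$ (realised, by the Sobolev inequality, as a space of functions in $L^{2N/(N-2)}(\mathbb R^N)$ with weak gradient in $L^2$), and let $$E=\Big\{u\in D^{1,2}_r(\mathbb R^N):\int_{\mathbb R^N}V(|x|)f(u)^2\,dx<\infty\Big\},\qquad \|u\|=\|u\|_{1,2}+\inf_{k>0}\frac1k\Big[1+\int_{\mathbb R^N}V(|x|)f(ku)^2\,dx\Big].$$ Let $q_1,q_2>1$, let $g:\mathbb R\to\mathbb R$ be continuous, put $G(t)=\int_0^t g(s)\,ds$, and assume: * there is $\theta>2$ such that $0\le 2\theta G(t)\le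 g(t)t$ for all $t\in\mathbb R$; * there is $t_0>0$ such that $G(t_0)>0$; * there is $C>0$ such that $|g(t)|\le C\min\{|t|^{q_1-1},|t|^{q_2-1}\}$ for all $t\in\mathbb R$; * there are $R_1,R_2>0$ such that $$\sup_{u\in E,\ \|u\|=1}\int_{B_{R_1}}K(|x|)|u|^{q_1}\,dx<\infty\quad\text{and}\quad \sup_{u\in E,\ \|u\|=1}\int_{\mathbb R^N\setminus B_{R_2}}K(|x|)|u|^{q_2}\,dx<\infty,$$ where $B_R=\{x\in\mathbb R^N:|x|<R\}$. Then the functional $$I(u)=\frac12\int_{\mathbb R^N}|\nabla u|^2\,dx+\frac12\int_{\mathbb R^N}V(|x|)f(u)^2\,dx-\int_{\mathbb R^N}K(|x|)G(f(u))\,dx$$ is well defined (all three integrands are integrable) and continuous on the normed space $E$. Moreover $I$ is a $C^1$ map on $E$ and, for every $u\in E$, its (Fréchet) differential is given by $$I'(u)h=\int_{\mathbb R^N}\nabla u\cdot\nabla h\,dx+\int_{\mathbb R^N}V(|x|)f(u)f'(u)h\,dx-\int_{\mathbb R^N}K(|x|)g(f(u))f'(u)h\,dx\qquad\text{for all }h\in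 E,$$ where all three integrands are integrable. -/

import Mathlib

open MeasureTheory Set Filter Topology
open scoped ENNReal NNReal ContDiff Gradient

noncomputable section

namespace OrliczSobolev

/-! The change of variable `f`. -/

/-- `f` solves the Cauchy problem `f' = 1 / √(1 + 2 f²)` on `ℝ`, `f 0 = 0`. -/
def SolvesCauchy (f : ℝ → ℝ) : Prop :=
  (∀ t : ℝ, HasDerivAt f (1 / Real.sqrt (1 + 2 * f t ^ 2)) t) ∧ f 0 = 0

lemma sqrt_weight_pos (s : ℝ) : 0 < Real.sqrt (1 + 2 * s ^ 2) :=
  Real.sqrt_pos.2 (by positivity)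

lemma hasDerivAt_primitive (s : ℝ) :
    HasDerivAt (fun s : ℝ => ∫ x in (0 : ℝ)..s, Real.sqrt (1 + 2 * x ^ 2))
      (Real.sqrt (1 + 2 * s ^ 2)) s := by
  have hc : Continuous (fun x : ℝ => Real.sqrt (1 + 2 * x ^ 2)) := by fun_prop
  exact (hc.integral_hasStrictDerivAt 0 s).hasDerivAt

theorem existsUnique_solvesCauchy : ∃! f : ℝ → ℝ, SolvesCauchy f := by
  set F : ℝ → ℝ := fun s : ℝ => ∫ x in (0 : ℝ)..s, Real.sqrt (1 + 2 * x ^ 2) with hF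
  have hFd : ∀ s, HasDerivAt F (Real.sqrt (1 + 2 * s ^ 2)) s := hasDerivAt_primitive
  have hF0 : F 0 = 0 := by simp [hF]
  have hFm : StrictMono F := strictMono_of_deriv_pos fun s => by
    rw [(hFd s).deriv]; exact sqrt_weight_pos s
  have hFc : Continuous F := continuous_iff_continuousAt.2 fun s => (hFd s).continuousAt
  have hmono : Monotone (fun s => F s - s) := by
    apply monotone_of_deriv_nonneg
    · exact fun s => ((hFd s).sub (hasDerivAt_id s)).differentiableAt
    · intro s
      have hd : HasDerivAt (fun s => F s - s) _ s := (hFd s).sub (hasDerivAt_id s)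
      rw [hd.deriv]
      have : 1 ≤ Real.sqrt (1 + 2 * s ^ 2) := Real.one_le_sqrt.2 (by nlinarith [sq_nonneg s])
      linarith
  have htop : Tendsto F atTop atTop := by
    refine tendsto_atTop_mono' atTop ?_ tendsto_id
    filter_upwards [eventually_ge_atTop 0] with s hs
    have := hmono hs
    simp only [hF0, id] at *
    linarith
  have hbot : Tendsto F atBot atBot := by
    refine tendsto_atBot_mono' atBot ?_ tendsto_id
    filter_upwards [eventually_le_atBot 0] with s hs
    have := hmono hs
    simp only [hF0, id] at *
    linarith
  have hsurj : Function.Surjective F := hFc.surjective htop hbot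
  let e : ℝ ≃o ℝ := hFm.orderIsoOfSurjective F hsurj
  have he : ∀ t, F (e.symm t) = t := fun t => e.apply_symm_apply t
  refine ⟨e.symm, ⟨fun t => ?_, ?_⟩, ?_⟩
  · rw [one_div]
    exact (hFd (e.symm t)).of_local_left_inverse e.symm.continuous.continuousAt
      (sqrt_weight_pos _).ne' (Eventually.of_forall he)
  · apply hFm.injective
    rw [he, hF0]
  · rintro g ⟨hg, hg0⟩
    funext t
    apply hFm.injective
    rw [he]
    have hd : ∀ x, HasDerivAt (fun x => F (g x) - x) 0 x := fun x => by
      have h := ((hFd (g x)).comp x (hg x)).sub (hasDerivAt_id x)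
      rwa [mul_one_div_cancel (sqrt_weight_pos _).ne', sub_self] at h
    have h := is_const_of_deriv_eq_zero (fun x => (hd x).differentiableAt)
      (fun x => (hd x).deriv) t 0
    simp only [hg0, hF0] at h
    linarith

/-- The change of variable: the unique solution of the Cauchy problem
`f' = 1 / √(1 + 2 f²)` on `ℝ`, `f 0 = 0`. -/
def chg : ℝ → ℝ := existsUnique_solvesCauchy.choose

lemma chg_hasDerivAt (t : ℝ) : HasDerivAt chg (1 / Real.sqrt (1 + 2 * chg t ^ 2)) t :=
  existsUnique_solvesCauchy.choose_spec.1.1 t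

lemma chg_zero : chg 0 = 0 := existsUnique_solvesCauchy.choose_spec.1.2

lemma chg_unique {g : ℝ → ℝ} (hg : SolvesCauchy g) : g = chg :=
  existsUnique_solvesCauchy.choose_spec.2 g hg

lemma chg_continuous : Continuous chg :=
  continuous_iff_continuousAt.2 fun s => (chg_hasDerivAt s).continuousAt

lemma chg_strictMono : StrictMono chg := strictMono_of_deriv_pos fun s => by
  rw [(chg_hasDerivAt s).deriv]; exact one_div_pos.2 (sqrt_weight_pos _)

lemma chg_neg (t : ℝ) : chg (-t) = -chg t := by
  have h : (fun t => -chg (-t)) = chg := chg_unique ⟨fun t => by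
    have h : HasDerivAt (fun t => -chg (-t)) _ t :=
      ((chg_hasDerivAt (-t)).comp t (hasDerivAt_neg t)).neg
    exact h.congr_deriv (by simp), by simp [chg_zero]⟩
  have h2 : -chg (-t) = chg t := congrFun h t
  linarith

lemma chg_sq_convexOn : ConvexOn ℝ univ (fun t => chg t ^ 2) := by
  have hd : ∀ t, HasDerivAt (fun t => chg t ^ 2)
      (2 * (chg t / Real.sqrt (1 + 2 * chg t ^ 2))) t := fun t => by
    have h : HasDerivAt (fun t => chg t ^ 2) _ t := (chg_hasDerivAt t).pow 2
    exact h.congr_deriv (by simp; ring)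
  apply Monotone.convexOn_univ_of_deriv (fun t => (hd t).differentiableAt)
  have : deriv (fun t => chg t ^ 2) =
      fun t => 2 * (chg t / Real.sqrt (1 + 2 * chg t ^ 2)) := funext fun t => (hd t).deriv
  rw [this]
  have key : Monotone (fun s : ℝ => s / Real.sqrt (1 + 2 * s ^ 2)) := by
    have hds : ∀ s : ℝ, HasDerivAt (fun s : ℝ => s / Real.sqrt (1 + 2 * s ^ 2))
        ((1 * Real.sqrt (1 + 2 * s ^ 2) - s * ((4 * s) / (2 * Real.sqrt (1 + 2 * s ^ 2))))
          / Real.sqrt (1 + 2 * s ^ 2) ^ 2) s := fun s => by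
      have h1 : HasDerivAt (fun s : ℝ => 1 + 2 * s ^ 2) (4 * s) s := by
        have h : HasDerivAt (fun s : ℝ => 1 + 2 * s ^ 2) _ s :=
          (((hasDerivAt_id s).pow 2).const_mul 2).const_add 1
        exact h.congr_deriv (by simp; ring)
      exact (hasDerivAt_id s).div (h1.sqrt (by positivity)) (sqrt_weight_pos s).ne'
    apply monotone_of_deriv_nonneg (fun s => (hds s).differentiableAt)
    intro s
    rw [(hds s).deriv]
    have hp := sqrt_weight_pos s
    have hs : Real.sqrt (1 + 2 * s ^ 2) ^ 2 = 1 + 2 * s ^ 2 := Real.sq_sqrt (by positivity)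
    apply div_nonneg _ (sq_nonneg _)
    rw [sub_nonneg, mul_div_assoc', div_le_iff₀ (by positivity)]
    nlinarith
  intro a b hab
  have := key (chg_strictMono.monotone hab)
  simp only at this ⊢
  linarith

/-- `f (a t + b s)² ≤ a f(t)² + b f(s)²` for a convex combination. -/
lemma chg_sq_convex (a b t s : ℝ) (ha : 0 ≤ a) (hb : 0 ≤ b) (hab : a + b = 1) :
    chg (a * t + b * s) ^ 2 ≤ a * chg t ^ 2 + b * chg s ^ 2 := by
  simpa using chg_sq_convexOn.2 (mem_univ t) (mem_univ s) ha hb hab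

lemma chg_sq_two_mul (t : ℝ) : chg (2 * t) ^ 2 ≤ 4 * chg t ^ 2 := by
  have hpos : ∀ t : ℝ, 0 ≤ t → chg (2 * t) ^ 2 ≤ 4 * chg t ^ 2 := by
    intro t ht
    have hd : ∀ s, HasDerivAt (fun s => 2 * chg s - chg (2 * s))
        (2 * (1 / Real.sqrt (1 + 2 * chg s ^ 2)) -
          1 / Real.sqrt (1 + 2 * chg (2 * s) ^ 2) * 2) s := fun s => by
      have h2 : HasDerivAt (fun s : ℝ => 2 * s) 2 s := by
        simpa using (hasDerivAt_id s).const_mul 2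
      exact ((chg_hasDerivAt s).const_mul 2).sub ((chg_hasDerivAt (2 * s)).comp s h2)
    have hm : MonotoneOn (fun s => 2 * chg s - chg (2 * s)) (Ici 0) := by
      apply monotoneOn_of_deriv_nonneg (convex_Ici 0)
      · exact fun s _ => (hd s).continuousAt.continuousWithinAt
      · exact fun s _ => (hd s).differentiableAt.differentiableWithinAt
      · intro s hs
        rw [interior_Ici, mem_Ioi] at hs
        rw [(hd s).deriv]
        have h0 : 0 ≤ chg s := by
          rw [← chg_zero]; exact chg_strictMono.monotone hs.le
        have h1 : chg s ≤ chg (2 * s) := chg_strictMono.monotone (by linarith)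
        have : 1 / Real.sqrt (1 + 2 * chg (2 * s) ^ 2) ≤ 1 / Real.sqrt (1 + 2 * chg s ^ 2) := by
          apply one_div_le_one_div_of_le (sqrt_weight_pos _)
          apply Real.sqrt_le_sqrt
          nlinarith
        linarith
    have h := hm (mem_Ici.2 le_rfl) (mem_Ici.2 ht) ht
    simp only [mul_zero, chg_zero, sub_zero] at h
    have h0 : 0 ≤ chg (2 * t) := by
      rw [← chg_zero]; exact chg_strictMono.monotone (by linarith)
    nlinarith
  rcases le_total 0 t with ht | ht
  · exact hpos t ht
  · have := hpos (-t) (by linarith)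
    rwa [mul_neg, chg_neg, chg_neg, neg_sq, neg_sq] at this

lemma chg_sq_add (t s : ℝ) : chg (t + s) ^ 2 ≤ 2 * chg t ^ 2 + 2 * chg s ^ 2 := by
  have h := chg_sq_convex (1 / 2) (1 / 2) (2 * t) (2 * s) (by norm_num) (by norm_num)
    (by norm_num)
  rw [show 1 / 2 * (2 * t) + 1 / 2 * (2 * s) = t + s by ring] at h
  linarith [chg_sq_two_mul t, chg_sq_two_mul s]

lemma chg_sq_abs (t : ℝ) : chg |t| ^ 2 = chg t ^ 2 := by
  rcases abs_cases t with ⟨h, _⟩ | ⟨h, _⟩ <;> rw [h]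
  rw [chg_neg, neg_sq]

lemma chg_sq_le_of_abs_le {t s : ℝ} (h : |t| ≤ |s|) : chg t ^ 2 ≤ chg s ^ 2 := by
  rw [← chg_sq_abs t, ← chg_sq_abs s]
  have h0 : 0 ≤ chg |t| := by
    rw [← chg_zero]; exact chg_strictMono.monotone (abs_nonneg t)
  exact pow_le_pow_left₀ h0 (chg_strictMono.monotone h) 2

lemma chg_sq_two_pow_mul (n : ℕ) (t : ℝ) : chg (2 ^ n * t) ^ 2 ≤ 4 ^ n * chg t ^ 2 := by
  induction n with
  | zero => simp
  | succ n ih =>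
    have h := chg_sq_two_mul (2 ^ n * t)
    rw [show (2 : ℝ) ^ (n + 1) * t = 2 * (2 ^ n * t) by ring,
      show (4 : ℝ) ^ (n + 1) = 4 * 4 ^ n by ring]
    linarith

lemma exists_chg_sq_mul_le (c : ℝ) : ∃ C : ℝ, ∀ t, chg (c * t) ^ 2 ≤ C * chg t ^ 2 := by
  obtain ⟨n, hn⟩ := pow_unbounded_of_one_lt |c| (one_lt_two)
  refine ⟨4 ^ n, fun t => le_trans (chg_sq_le_of_abs_le ?_) (chg_sq_two_pow_mul n t)⟩
  rw [abs_mul, abs_mul, abs_of_pos (by positivity : (0 : ℝ) < 2 ^ n)]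
  gcongr

/-! Radial functions of finite Dirichlet energy. -/

/-- The Euclidean space `ℝᴺ`. -/
abbrev Rn (N : ℕ) : Type := EuclideanSpace ℝ (Fin N)

/-- The critical Sobolev exponent `2* = 2N / (N - 2)`, for `N ≥ 3`. -/
def critExp (N : ℕ) : ℝ≥0 := 2 * N / ((N : ℝ≥0) - 2)

lemma critExp_coe (N : ℕ) [h : Fact (3 ≤ N)] : (critExp N : ℝ) = 2 * N / ((N : ℝ) - 2) := by
  have : (2 : ℝ≥0) ≤ N := by exact_mod_cast (by have := h.out; omega : 2 ≤ N)
  simp [critExp, NNReal.coe_sub this]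

instance fact_one_le_critExp (N : ℕ) [h : Fact (3 ≤ N)] :
    Fact ((1 : ℝ≥0∞) ≤ (critExp N : ℝ≥0∞)) := ⟨by
  have h3 : (3 : ℝ) ≤ N := by exact_mod_cast h.out
  have : (1 : ℝ) ≤ critExp N := by
    rw [critExp_coe, le_div_iff₀ (by linarith)]
    linarith
  exact_mod_cast this⟩

/-- Radial functions in `C_c^∞(ℝᴺ)`. -/
structure IsRadialTest {N : ℕ} (φ : Rn N → ℝ) : Prop where
  smooth : ContDiff ℝ ∞ φ
  compactSupport : HasCompactSupport φ
  radial : ∀ x y : Rn N, ‖x‖ = ‖y‖ → φ x = φ y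

lemma continuous_gradient {N : ℕ} {φ : Rn N → ℝ} (h : ContDiff ℝ ∞ φ) :
    Continuous (∇ φ) := by
  have : Continuous (fderiv ℝ φ) := h.continuous_fderiv (by simp)
  exact (InnerProductSpace.toDual ℝ (Rn N)).symm.continuous.comp this

lemma hasCompactSupport_gradient {N : ℕ} {φ : Rn N → ℝ} (h : HasCompactSupport φ) :
    HasCompactSupport (∇ φ) :=
  (h.fderiv (𝕜 := ℝ)).comp_left (g := (InnerProductSpace.toDual ℝ (Rn N)).symm) (map_zero _)

/-- Pairs `(u, G)` of a function in `L^{2*}(ℝᴺ)` and a vector field in `L²(ℝᴺ)`. -/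
abbrev Pairs (N : ℕ) [Fact (3 ≤ N)] : Type :=
  Lp ℝ (critExp N : ℝ≥0∞) (volume : Measure (Rn N)) × Lp (Rn N) 2 (volume : Measure (Rn N))

/-- The linear space of the pairs `(φ, ∇φ)`, `φ ∈ C_{c,r}^∞(ℝᴺ)`. -/
def testPairs (N : ℕ) [Fact (3 ≤ N)] : Submodule ℝ (Pairs N) where
  carrier := {p | ∃ φ : Rn N → ℝ, IsRadialTest φ ∧ p.1 =ᵐ[volume] φ ∧ p.2 =ᵐ[volume] ∇ φ}
  zero_mem' := by
    refine ⟨fun _ => 0, ⟨contDiff_const, .zero, fun _ _ _ => rfl⟩, Lp.coeFn_zero _ _ _, ?_⟩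
    refine (Lp.coeFn_zero _ _ _).trans (Eventually.of_forall fun x => ?_)
    simp [gradient]
  add_mem' := by
    rintro p q ⟨φ, hφ, h1, h2⟩ ⟨ψ, hψ, h3, h4⟩
    refine ⟨fun x => φ x + ψ x, ⟨hφ.smooth.add hψ.smooth, hφ.compactSupport.add hψ.compactSupport,
      fun x y h => by rw [hφ.radial x y h, hψ.radial x y h]⟩, ?_, ?_⟩
    · filter_upwards [Lp.coeFn_add p.1 q.1, h1, h3] with x a b c
      simpa [b, c] using a
    · filter_upwards [Lp.coeFn_add p.2 q.2, h2, h4] with x a b c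
      have hd : ∇ (fun x => φ x + ψ x) x = ∇ φ x + ∇ ψ x := by
        unfold gradient
        rw [fderiv_fun_add (hφ.smooth.differentiable (by simp) x)
          (hψ.smooth.differentiable (by simp) x), map_add]
      rw [hd, ← b, ← c]
      exact a
  smul_mem' := by
    rintro c p ⟨φ, hφ, h1, h2⟩
    refine ⟨fun x => c * φ x, ⟨contDiff_const.mul hφ.smooth, hφ.compactSupport.mul_left,
      fun x y h => by rw [hφ.radial x y h]⟩, ?_, ?_⟩
    · filter_upwards [Lp.coeFn_smul c p.1, h1] with x a b
      simpa [b] using a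
    · filter_upwards [Lp.coeFn_smul c p.2, h2] with x a b
      have hd : ∇ (fun x => c * φ x) x = c • ∇ φ x := by
        unfold gradient
        rw [fderiv_const_mul (hφ.smooth.differentiable (by simp) x), map_smul]
      rw [hd, ← b]
      exact a

/-- The space `D_r^{1,2}(ℝᴺ)`: the closure of `C_{c,r}^∞(ℝᴺ)` in the norm `‖∇u‖_{L²}`. By the
Sobolev inequality `‖φ‖_{2*} ≤ C ‖∇φ‖₂` (see `exists_sobolev`) this norm is equivalent on test
functions to `‖φ‖_{2*} + ‖∇φ‖₂`, so that the closure is the closure of the pairs `(φ, ∇φ)` in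
`L^{2*} × L²`. The second component is the weak gradient of the first one
(see `weakGradient_of_mem`) and is determined by it (see `snd_eq_of_fst_eq`). -/
def DirichletRadial (N : ℕ) [Fact (3 ≤ N)] : Submodule ℝ (Pairs N) :=
  (testPairs N).topologicalClosure

lemma exists_sobolev (N : ℕ) [h : Fact (3 ≤ N)] :
    ∃ C : ℝ, ∀ p ∈ DirichletRadial N, ‖p.1‖ ≤ C * ‖p.2‖ := by
  have h3 : (3 : ℝ) ≤ N := by exact_mod_cast h.out
  set C := eLpNormLESNormFDerivOfEqInnerConst (volume : Measure (Rn N)) (2 : ℝ) with hC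
  refine ⟨C, fun p hp => ?_⟩
  have hcl : IsClosed {p : Pairs N | ‖p.1‖ ≤ C * ‖p.2‖} :=
    isClosed_le (by fun_prop) (by fun_prop)
  have hsub : (testPairs N : Set (Pairs N)) ⊆ {p : Pairs N | ‖p.1‖ ≤ C * ‖p.2‖} := by
    rintro p ⟨φ, hφ, h1, h2⟩
    have hS := eLpNorm_le_eLpNorm_fderiv_of_eq_inner (F' := ℝ) (volume : Measure (Rn N))
      (u := φ) (p := 2) (p' := critExp N)
      (hφ.smooth.of_le (by simp)) hφ.compactSupport (by norm_num)
      (by rw [finrank_euclideanSpace_fin]; have := h.out; omega)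
      (by
        rw [critExp_coe, finrank_euclideanSpace_fin]
        have : (N : ℝ) - 2 ≠ 0 := by linarith
        have : (N : ℝ) ≠ 0 := by linarith
        push_cast
        field_simp)
    have hg : eLpNorm (fderiv ℝ φ) ((2 : ℝ≥0) : ℝ≥0∞) (volume : Measure (Rn N))
        = eLpNorm p.2 2 volume := by
      rw [eLpNorm_congr_ae h2]
      push_cast
      apply eLpNorm_congr_norm_ae
      exact Eventually.of_forall fun x => by simp [gradient]
    rw [hg, ← eLpNorm_congr_ae h1] at hS
    have := ENNReal.toReal_mono (ENNReal.mul_ne_top ENNReal.coe_ne_top (Lp.eLpNorm_ne_top p.2)) hS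
    rw [ENNReal.toReal_mul] at this
    simpa [Lp.norm_def] using this
  exact closure_minimal hsub hcl hp

/-- The second component of an element of `D_r^{1,2}(ℝᴺ)` is the weak gradient of the first. -/
lemma weakGradient_of_mem {N : ℕ} [Fact (3 ≤ N)] {p : Pairs N} (hp : p ∈ DirichletRadial N)
    {ψ : Rn N → ℝ} (hψ : ContDiff ℝ ∞ ψ) (hψc : HasCompactSupport ψ) (v : Rn N) :
    ∫ x, p.1 x * fderiv ℝ ψ x v = -∫ x, inner ℝ v (p.2 x) * ψ x := by
  have hdc : Continuous (fun x => fderiv ℝ ψ x v) :=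
    (hψ.continuous_fderiv (by simp)).clm_apply continuous_const
  have hds : HasCompactSupport (fun x => fderiv ℝ ψ x v) := hψc.fderiv_apply (𝕜 := ℝ) v
  let a : ℝ≥0∞ := ENNReal.conjExponent (critExp N)
  have : ENNReal.HolderConjugate (critExp N : ℝ≥0∞) a :=
    ENNReal.HolderConjugate.conjExponent (Fact.out)
  have : Fact (1 ≤ a) := ⟨ENNReal.HolderConjugate.one_le a (critExp N : ℝ≥0∞)⟩
  let A : Lp ℝ a (volume : Measure (Rn N)) := (hdc.memLp_of_hasCompactSupport hds).toLp _
  let B : Lp ℝ 2 (volume : Measure (Rn N)) :=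
    (hψ.continuous.memLp_of_hasCompactSupport hψc).toLp _
  let T : ℝ →L[ℝ] ℝ →L[ℝ] ℝ := ContinuousLinearMap.mul ℝ ℝ
  let S : Rn N →L[ℝ] ℝ →L[ℝ] ℝ := (ContinuousLinearMap.mul ℝ ℝ).comp (innerSL ℝ v)
  have e1 : ∀ u : Lp ℝ (critExp N : ℝ≥0∞) (volume : Measure (Rn N)),
      T.lpPairing volume _ a u A = ∫ x, u x * fderiv ℝ ψ x v := fun u => by
    rw [ContinuousLinearMap.lpPairing_eq_integral]
    apply integral_congr_ae
    filter_upwards [(hdc.memLp_of_hasCompactSupport hds).coeFn_toLp (p := a) (μ := volume)]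
      with x hx
    simp [T, A, hx]
  have e2 : ∀ G : Lp (Rn N) 2 (volume : Measure (Rn N)),
      S.lpPairing volume 2 2 G B = ∫ x, inner ℝ v (G x) * ψ x := fun G => by
    rw [ContinuousLinearMap.lpPairing_eq_integral]
    apply integral_congr_ae
    filter_upwards [(hψ.continuous.memLp_of_hasCompactSupport hψc).coeFn_toLp
      (p := 2) (μ := volume)] with x hx
    simp [S, B, hx]
  rw [← e1, ← e2]
  have hcl : IsClosed {p : Pairs N |
      T.lpPairing volume _ a p.1 A = -S.lpPairing volume 2 2 p.2 B} := by
    refine isClosed_eq ?_ ?_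
    · exact ((T.lpPairing volume _ a).flip A).continuous.comp continuous_fst
    · exact (((S.lpPairing volume 2 2).flip B).continuous.comp continuous_snd).neg
  have hsub : (testPairs N : Set (Pairs N)) ⊆ {p : Pairs N |
      T.lpPairing volume _ a p.1 A = -S.lpPairing volume 2 2 p.2 B} := by
    rintro q ⟨φ, hφ, h1, h2⟩
    rw [mem_ofPred_eq, e1, e2]
    have f1 : ∫ x, q.1 x * fderiv ℝ ψ x v = ∫ x, φ x * fderiv ℝ ψ x v :=
      integral_congr_ae (by filter_upwards [h1] with x hx; rw [hx])
    have f2 : ∫ x, inner ℝ v (q.2 x) * ψ x = ∫ x, fderiv ℝ φ x v * ψ x :=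
      integral_congr_ae (by
        filter_upwards [h2] with x hx
        rw [hx, real_inner_comm, inner_gradient_left])
    rw [f1, f2]
    have hφd : Continuous (fun x => fderiv ℝ φ x v) :=
      (hφ.smooth.continuous_fderiv (by simp)).clm_apply continuous_const
    apply integral_mul_fderiv_eq_neg_fderiv_mul_of_integrable
    · exact (hφd.mul hψ.continuous).integrable_of_hasCompactSupport hψc.mul_left
    · exact (hφ.smooth.continuous.mul hdc).integrable_of_hasCompactSupport hds.mul_left
    · exact (hφ.smooth.continuous.mul hψ.continuous).integrable_of_hasCompactSupport hψc.mul_left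
    · exact fun x _ => hφ.smooth.differentiable (by simp) x
    · exact fun x _ => hψ.differentiable (by simp) x
  exact closure_minimal hsub hcl hp

/-- The gradient of an element of `D_r^{1,2}(ℝᴺ)` is determined by the function. -/
lemma snd_eq_of_fst_eq {N : ℕ} [Fact (3 ≤ N)] {p q : Pairs N} (hp : p ∈ DirichletRadial N)
    (hq : q ∈ DirichletRadial N) (h : p.1 = q.1) : p.2 = q.2 := by
  have hd : p - q ∈ DirichletRadial N := sub_mem hp hq
  have h0 : (p - q).1 = 0 := by simp [h]
  have hae : ∀ v : Rn N, ∀ᵐ x, (inner ℝ v ((p - q).2 x) : ℝ) = 0 := fun v => by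
    have hloc : LocallyIntegrable (fun x => (inner ℝ v ((p - q).2 x) : ℝ))
        (volume : Measure (Rn N)) :=
      ((Lp.memLp (p - q).2).const_inner v).locallyIntegrable (by norm_num)
    refine ae_eq_zero_of_integral_contDiff_smul_eq_zero hloc fun ψ hψ hψc => ?_
    have hw := weakGradient_of_mem hd hψ hψc v
    have hz : ∫ x, (p - q).1 x * fderiv ℝ ψ x v = 0 := by
      rw [h0]
      apply integral_eq_zero_of_ae
      filter_upwards [Lp.coeFn_zero ℝ (critExp N : ℝ≥0∞) (volume : Measure (Rn N))] with x hx
      rw [hx]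
      simp
    rw [hz] at hw
    simp only [smul_eq_mul, mul_comm (ψ _)]
    linarith
  have hall : ∀ᵐ x, ∀ i : Fin N, (inner ℝ (EuclideanSpace.single i (1 : ℝ)) ((p - q).2 x) : ℝ) = 0 :=
    ae_all_iff.2 fun i => hae _
  have hz : (p - q).2 = 0 := by
    rw [Lp.eq_zero_iff_ae_eq_zero]
    filter_upwards [hall] with x hx
    ext i
    have h1 := hx i
    rw [EuclideanSpace.inner_single_left, map_one, one_mul] at h1
    exact h1
  rw [← sub_eq_zero]
  exact hz

/-! The Orlicz-Sobolev space `E`. -/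

/-- The measure `V(|x|) dx` on `ℝᴺ` (for a potential `V` that is nonnegative on `(0, ∞)`). -/
def potentialMeasure (N : ℕ) (V : ℝ → ℝ) : Measure (Rn N) :=
  volume.withDensity fun x => ENNReal.ofReal (V ‖x‖)

/-- The Orlicz norm `‖u‖ₒ = inf_{k > 0} (1/k) (1 + ∫ V(|x|) f(k u)² dx)`. -/
def orliczNorm {N : ℕ} (V : ℝ → ℝ) (u : Rn N → ℝ) : ℝ :=
  ⨅ k : Ioi (0 : ℝ), 1 / (k : ℝ) * (1 + ∫ x, chg (k * u x) ^ 2 ∂(potentialMeasure N V))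

section Orlicz

variable {N : ℕ} {V : ℝ → ℝ}

lemma orliczNorm_bddBelow (u : Rn N → ℝ) : BddBelow (range fun k : Ioi (0 : ℝ) =>
    1 / (k : ℝ) * (1 + ∫ x, chg (k * u x) ^ 2 ∂(potentialMeasure N V))) := by
  refine ⟨0, ?_⟩
  rintro _ ⟨k, rfl⟩
  have hk : (0 : ℝ) < k := k.2
  have : 0 ≤ ∫ x, chg (k * u x) ^ 2 ∂(potentialMeasure N V) :=
    integral_nonneg fun x => sq_nonneg _
  positivity

lemma orliczNorm_nonneg (u : Rn N → ℝ) : 0 ≤ orliczNorm V u := by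
  refine Real.iInf_nonneg fun k => ?_
  have hk : (0 : ℝ) < k := k.2
  have : 0 ≤ ∫ x, chg (k * u x) ^ 2 ∂(potentialMeasure N V) :=
    integral_nonneg fun x => sq_nonneg _
  positivity

lemma orliczNorm_le (u : Rn N → ℝ) {k : ℝ} (hk : 0 < k) :
    orliczNorm V u ≤ 1 / k * (1 + ∫ x, chg (k * u x) ^ 2 ∂(potentialMeasure N V)) :=
  ciInf_le (orliczNorm_bddBelow u) (⟨k, hk⟩ : Ioi (0 : ℝ))

lemma orliczNorm_congr {u v : Rn N → ℝ} (h : u =ᵐ[volume] v) :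
    orliczNorm V u = orliczNorm V v := by
  have h' : u =ᵐ[potentialMeasure N V] v :=
    (withDensity_absolutelyContinuous _ _).ae_eq h
  unfold orliczNorm
  refine iInf_congr fun k => ?_
  congr 2
  exact integral_congr_ae (by filter_upwards [h'] with x hx; rw [hx])

lemma integrable_chg_mul {u : Rn N → ℝ} (hm : AEStronglyMeasurable u volume)
    (hu : Integrable (fun x => chg (u x) ^ 2) (potentialMeasure N V)) (c : ℝ) :
    Integrable (fun x => chg (c * u x) ^ 2) (potentialMeasure N V) := by
  obtain ⟨C, hC⟩ := exists_chg_sq_mul_le c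
  have hm' : AEStronglyMeasurable u (potentialMeasure N V) :=
    hm.mono_ac (withDensity_absolutelyContinuous _ _)
  refine (hu.const_mul C).mono' ?_ (Eventually.of_forall fun x => ?_)
  · exact (chg_continuous.comp_aestronglyMeasurable (hm'.const_mul c)).pow 2
  · rw [Real.norm_of_nonneg (sq_nonneg _)]
    exact hC _

lemma integrable_chg_add {u v : Rn N → ℝ} (hmu : AEStronglyMeasurable u volume)
    (hmv : AEStronglyMeasurable v volume)
    (hu : Integrable (fun x => chg (u x) ^ 2) (potentialMeasure N V))
    (hv : Integrable (fun x => chg (v x) ^ 2) (potentialMeasure N V)) :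
    Integrable (fun x => chg (u x + v x) ^ 2) (potentialMeasure N V) := by
  have hm' : AEStronglyMeasurable (fun x => u x + v x) (potentialMeasure N V) :=
    (hmu.add hmv).mono_ac (withDensity_absolutelyContinuous _ _)
  refine ((hu.const_mul 2).add (hv.const_mul 2)).mono' ?_ (Eventually.of_forall fun x => ?_)
  · exact (chg_continuous.comp_aestronglyMeasurable hm').pow 2
  · rw [Real.norm_of_nonneg (sq_nonneg _)]
    exact chg_sq_add _ _

lemma orliczNorm_add_le {u v : Rn N → ℝ} (hmu : AEStronglyMeasurable u volume)
    (hmv : AEStronglyMeasurable v volume)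
    (hu : Integrable (fun x => chg (u x) ^ 2) (potentialMeasure N V))
    (hv : Integrable (fun x => chg (v x) ^ 2) (potentialMeasure N V)) :
    orliczNorm V (fun x => u x + v x) ≤ orliczNorm V u + orliczNorm V v := by
  refine le_ciInf_add_ciInf fun ⟨k, hk⟩ ⟨l, hl⟩ => ?_
  have hk : 0 < k := hk
  have hl : 0 < l := hl
  have hkl : 0 < k + l := add_pos hk hl
  have hm : 0 < k * l / (k + l) := by positivity
  refine (orliczNorm_le _ hm).trans ?_
  have hpt : ∀ x, chg (k * l / (k + l) * (u x + v x)) ^ 2 ≤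
      l / (k + l) * chg (k * u x) ^ 2 + k / (k + l) * chg (l * v x) ^ 2 := fun x => by
    have h := chg_sq_convex (l / (k + l)) (k / (k + l)) (k * u x) (l * v x) (by positivity)
      (by positivity) (by field_simp; ring)
    convert h using 3
    ring
  have hI := integral_mono
    (integrable_chg_mul (hmu.add hmv) (integrable_chg_add hmu hmv hu hv) (k * l / (k + l)))
    (((integrable_chg_mul hmu hu k).const_mul (l / (k + l))).add
      ((integrable_chg_mul hmv hv l).const_mul (k / (k + l)))) hpt
  have hsum := integral_add ((integrable_chg_mul hmu hu k).const_mul (l / (k + l)))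
      ((integrable_chg_mul hmv hv l).const_mul (k / (k + l)))
  rw [integral_const_mul, integral_const_mul] at hsum
  simp only [Pi.add_apply] at hI
  rw [hsum] at hI
  set a := ∫ x, chg (k * u x) ^ 2 ∂(potentialMeasure N V)
  set b := ∫ x, chg (l * v x) ^ 2 ∂(potentialMeasure N V)
  calc 1 / (k * l / (k + l)) *
        (1 + ∫ x, chg (k * l / (k + l) * (u x + v x)) ^ 2 ∂(potentialMeasure N V))
      ≤ 1 / (k * l / (k + l)) * (1 + (l / (k + l) * a + k / (k + l) * b)) := by gcongr
    _ = 1 / k * (1 + a) + 1 / l * (1 + b) := by field_simp; ring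

lemma orliczNorm_smul_le (c : ℝ) (hc : c ≠ 0) (u : Rn N → ℝ) :
    orliczNorm V (fun x => c * u x) ≤ |c| * orliczNorm V u := by
  unfold orliczNorm
  rw [Real.mul_iInf_of_nonneg (abs_nonneg c)]
  refine le_ciInf fun ⟨k, hk⟩ => ?_
  have hk : 0 < k := hk
  have hc' : 0 < |c| := abs_pos.2 hc
  refine (orliczNorm_le (V := V) (fun x => c * u x) (div_pos hk hc')).trans (le_of_eq ?_)
  have : ∀ x, chg (k / |c| * (c * u x)) ^ 2 = chg (k * u x) ^ 2 := fun x => by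
    rw [← chg_sq_abs, ← chg_sq_abs (k * u x)]
    congr 2
    rw [abs_mul, abs_mul, abs_mul, abs_div, abs_abs]
    field_simp
  simp only [this]
  field_simp

lemma orliczNorm_zero : orliczNorm V (fun _ : Rn N => (0 : ℝ)) = 0 := by
  refine le_antisymm (le_of_forall_pos_le_add fun ε hε => ?_) (orliczNorm_nonneg _)
  have h := orliczNorm_le (V := V) (fun _ : Rn N => (0 : ℝ)) (k := 1 / ε) (by positivity)
  simpa [chg_zero] using h

lemma orliczNorm_smul (c : ℝ) (u : Rn N → ℝ) :
    orliczNorm V (fun x => c * u x) = |c| * orliczNorm V u := by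
  rcases eq_or_ne c 0 with rfl | hc
  · simp [orliczNorm_zero]
  · refine le_antisymm (orliczNorm_smul_le c hc u) ?_
    have h := orliczNorm_smul_le (V := V) c⁻¹ (inv_ne_zero hc) (fun x => c * u x)
    simp only [inv_mul_cancel_left₀ hc, abs_inv] at h
    have hc' : 0 < |c| := abs_pos.2 hc
    rwa [inv_mul_eq_div, le_div_iff₀ hc', mul_comm] at h

end Orlicz

/-- The linear space of the `u ∈ D_r^{1,2}(ℝᴺ)` with `∫ V(|x|) f(u)² dx < ∞`. -/
def orliczSobolev (N : ℕ) [Fact (3 ≤ N)] (V : ℝ → ℝ) : Submodule ℝ (Pairs N) where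
  carrier := {p | p ∈ DirichletRadial N ∧
    Integrable (fun x => chg (p.1 x) ^ 2) (potentialMeasure N V)}
  zero_mem' := by
    refine ⟨zero_mem _, ?_⟩
    have h0 : (fun x => chg ((0 : Pairs N).1 x) ^ 2) =ᵐ[potentialMeasure N V] fun _ => 0 := by
      refine (withDensity_absolutelyContinuous _ _).ae_eq ?_
      filter_upwards [Lp.coeFn_zero ℝ (critExp N : ℝ≥0∞) (volume : Measure (Rn N))] with x hx
      rw [Prod.fst_zero, hx]
      simp [chg_zero]
    exact (integrable_zero _ _ _).congr h0.symm
  add_mem' := by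
    rintro p q ⟨hp, hp'⟩ ⟨hq, hq'⟩
    refine ⟨add_mem hp hq, ?_⟩
    refine (integrable_chg_add (Lp.aestronglyMeasurable p.1) (Lp.aestronglyMeasurable q.1)
      hp' hq').congr ?_
    refine (withDensity_absolutelyContinuous _ _).ae_eq ?_
    filter_upwards [Lp.coeFn_add p.1 q.1] with x hx
    rw [Prod.fst_add, hx, Pi.add_apply]
  smul_mem' := by
    rintro c p ⟨hp, hp'⟩
    refine ⟨Submodule.smul_mem _ c hp, ?_⟩
    refine (integrable_chg_mul (Lp.aestronglyMeasurable p.1) hp' c).congr ?_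
    refine (withDensity_absolutelyContinuous _ _).ae_eq ?_
    filter_upwards [Lp.coeFn_smul c p.1] with x hx
    rw [Prod.smul_fst, hx, Pi.smul_apply, smul_eq_mul]

/-- The Orlicz-Sobolev space `E = {u ∈ D_r^{1,2}(ℝᴺ) | ∫ V(|x|) f(u)² dx < ∞}`. This is a copy of
the type of elements of `orliczSobolev N V`, which gets its own norm below. -/
def E (N : ℕ) [Fact (3 ≤ N)] (V : ℝ → ℝ) : Type := orliczSobolev N V

namespace E

variable {N : ℕ} [Fact (3 ≤ N)] {V : ℝ → ℝ}

instance : AddCommGroup (E N V) := inferInstanceAs (AddCommGroup (orliczSobolev N V))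

instance : Module ℝ (E N V) := inferInstanceAs (Module ℝ (orliczSobolev N V))

/-- The pair `(u, ∇u)` behind an element `u` of `E`. -/
def toPair (u : E N V) : Pairs N := Subtype.val (p := fun p => p ∈ orliczSobolev N V) u

/-- An element of `E` as a function on `ℝᴺ` (defined almost everywhere). -/
instance : CoeFun (E N V) (fun _ => Rn N → ℝ) := ⟨fun u => u.toPair.1⟩

/-- The (weak) gradient `∇u` of an element `u` of `E`. -/
def grad (u : E N V) : Rn N → Rn N := u.toPair.2

lemma toPair_mem (u : E N V) : u.toPair ∈ DirichletRadial N :=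
  (Subtype.prop (p := fun p => p ∈ orliczSobolev N V) u).1

lemma integrable_chg (u : E N V) : Integrable (fun x => chg (u x) ^ 2) (potentialMeasure N V) :=
  (Subtype.prop (p := fun p => p ∈ orliczSobolev N V) u).2

lemma toPair_injective : Function.Injective (toPair : E N V → Pairs N) :=
  Subtype.val_injective

lemma toPair_add (u v : E N V) : (u + v).toPair = u.toPair + v.toPair := rfl

lemma toPair_smul (c : ℝ) (u : E N V) : (c • u).toPair = c • u.toPair := rfl

lemma toPair_zero : (0 : E N V).toPair = 0 := rfl

/-- Elements of `E` are determined by the underlying function. -/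
lemma ext_fun {u v : E N V} (h : u =ᵐ[volume] v) : u = v := by
  have h1 : u.toPair.1 = v.toPair.1 := Lp.ext h
  exact toPair_injective (Prod.ext h1 (snd_eq_of_fst_eq u.toPair_mem v.toPair_mem h1))

/-- The norm `‖u‖ = ‖∇u‖_{L²} + ‖u‖ₒ`. -/
instance : Norm (E N V) := ⟨fun u => ‖u.toPair.2‖ + orliczNorm V u⟩

lemma norm_def (u : E N V) : ‖u‖ = ‖u.toPair.2‖ + orliczNorm V u := rfl

lemma normedSpaceCore : NormedSpace.Core ℝ (E N V) where
  norm_nonneg u := add_nonneg (norm_nonneg _) (orliczNorm_nonneg _)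
  norm_smul c u := by
    have h : ((c • u : E N V) : Rn N → ℝ) =ᵐ[volume] fun x => c * u x := by
      filter_upwards [Lp.coeFn_smul c u.toPair.1] with x hx
      rw [toPair_smul, Prod.smul_fst, hx, Pi.smul_apply, smul_eq_mul]
    rw [norm_def, norm_def, orliczNorm_congr h, orliczNorm_smul, toPair_smul, Prod.smul_snd,
      norm_smul, Real.norm_eq_abs, mul_add]
  norm_triangle u v := by
    have h : ((u + v : E N V) : Rn N → ℝ) =ᵐ[volume] fun x => u x + v x := by
      filter_upwards [Lp.coeFn_add u.toPair.1 v.toPair.1] with x hx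
      rw [toPair_add, Prod.fst_add, hx, Pi.add_apply]
    rw [norm_def, norm_def, norm_def, orliczNorm_congr h, toPair_add, Prod.snd_add]
    have h1 := norm_add_le u.toPair.2 v.toPair.2
    have h2 := orliczNorm_add_le (V := V) (Lp.aestronglyMeasurable u.toPair.1)
      (Lp.aestronglyMeasurable v.toPair.1) u.integrable_chg v.integrable_chg
    linarith
  norm_eq_zero_iff u := by
    constructor
    · intro h
      have h0 := orliczNorm_nonneg (V := V) (u : Rn N → ℝ)
      have h1 := norm_nonneg u.toPair.2
      rw [norm_def] at h
      have h2 : ‖u.toPair.2‖ = 0 := by linarith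
      obtain ⟨C, hC⟩ := exists_sobolev N
      have h3 := hC _ u.toPair_mem
      rw [h2, mul_zero] at h3
      apply toPair_injective
      rw [toPair_zero]
      exact Prod.ext (norm_le_zero_iff.1 h3) (norm_eq_zero.1 h2)
    · rintro rfl
      have h : ((0 : E N V) : Rn N → ℝ) =ᵐ[volume] fun _ => 0 := Lp.coeFn_zero _ _ _
      rw [norm_def, orliczNorm_congr h, orliczNorm_zero, toPair_zero]
      simp

instance : NormedAddCommGroup (E N V) := NormedAddCommGroup.ofCore normedSpaceCore

instance : NormedSpace ℝ (E N V) := NormedSpace.ofCore normedSpaceCore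

end E

/-! The hypotheses, and the functional. -/

/-- The potentials: `V ≥ 0` and `K > 0` are continuous on `(0, ∞)` and `V(r) ≤ C / r²` on
`(0, 1)`. -/
structure HypH (V K : ℝ → ℝ) : Prop where
  continuousOn_V : ContinuousOn V (Ioi 0)
  continuousOn_K : ContinuousOn K (Ioi 0)
  V_nonneg : ∀ r > 0, 0 ≤ V r
  K_pos : ∀ r > 0, 0 < K r
  V_le : ∃ C > 0, ∀ r ∈ Ioo (0 : ℝ) 1, V r ≤ C / r ^ 2

/-- The primitive `G(t) = ∫₀ᵗ g(s) ds`. -/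
def primitive (g : ℝ → ℝ) (t : ℝ) : ℝ := ∫ s in (0 : ℝ)..t, g s

/-- There is `θ > 2` with `0 ≤ 2 θ G(t) ≤ g(t) t` for all `t`. -/
def HypG1 (g : ℝ → ℝ) : Prop :=
  ∃ θ > 2, ∀ t, 0 ≤ 2 * θ * primitive g t ∧ 2 * θ * primitive g t ≤ g t * t

/-- There is `t₀ > 0` with `G(t₀) > 0`. -/
def HypG2 (g : ℝ → ℝ) : Prop := ∃ t₀ > 0, 0 < primitive g t₀

/-- Double-power growth: `|g(t)| ≤ C min {|t|^(q₁-1), |t|^(q₂-1)}` for all `t`. -/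
def HypGrowth (g : ℝ → ℝ) (q₁ q₂ : ℝ) : Prop :=
  ∃ C > 0, ∀ t, |g t| ≤ C * min (|t| ^ (q₁ - 1)) (|t| ^ (q₂ - 1))

/-- `S₀(q, R)`, the supremum of `∫_{B_R} K(|x|) |u|^q dx` over the unit sphere of `E`. -/
def S₀ (N : ℕ) [Fact (3 ≤ N)] (V K : ℝ → ℝ) (q R : ℝ) : ℝ≥0∞ :=
  ⨆ (u : E N V) (_ : ‖u‖ = 1),
    ∫⁻ x in Metric.ball (0 : Rn N) R, ENNReal.ofReal (K ‖x‖ * |u x| ^ q)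

/-- `S_∞(q, R)`, the supremum of `∫_{ℝᴺ ∖ B_R} K(|x|) |u|^q dx` over the unit sphere of `E`. -/
def SInfty (N : ℕ) [Fact (3 ≤ N)] (V K : ℝ → ℝ) (q R : ℝ) : ℝ≥0∞ :=
  ⨆ (u : E N V) (_ : ‖u‖ = 1),
    ∫⁻ x in (Metric.ball (0 : Rn N) R)ᶜ, ENNReal.ofReal (K ‖x‖ * |u x| ^ q)

/-- `S₀(q₁, R₁)` and `S_∞(q₂, R₂)` are finite for some `R₁, R₂ > 0`. -/
def CondS (N : ℕ) [Fact (3 ≤ N)] (V K : ℝ → ℝ) (q₁ q₂ : ℝ) : Prop :=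
  ∃ R₁ > 0, ∃ R₂ > 0, S₀ N V K q₁ R₁ < ⊤ ∧ SInfty N V K q₂ R₂ < ⊤

/-- The functional
`I(u) = ½ ∫ |∇u|² dx + ½ ∫ V(|x|) f(u)² dx - ∫ K(|x|) G(f(u)) dx` on `E`. -/
def functional (N : ℕ) [Fact (3 ≤ N)] (V K g : ℝ → ℝ) (u : E N V) : ℝ :=
  1 / 2 * (∫ x, ‖u.grad x‖ ^ 2) + 1 / 2 * (∫ x, V ‖x‖ * chg (u x) ^ 2)
    - ∫ x, K ‖x‖ * primitive g (chg (u x))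

end OrliczSobolev

end

/-! The functional is a sum of three terms, each of which factors through a continuous linear map
from E into a Lebesgue space. On L^p(μ) with p > 1, the functional w ↦ ∫ Φ(w) dμ is C¹ as soon as
Φ(0) = 0 and φ = Φ' is continuous with |φ(t)| ≤ C|t|^(p-1): the operator w ↦ φ∘w is continuous from
L^p into its dual L^{p'}, and the first order Taylor remainder divided by the increment tends to 0
in L^{p'}, so Hölder's inequality gives differentiability (`exists_hasFDerivAt_integral_comp`). What
remains is to find the embeddings.

The gradient term is half the squared norm of ∇u in L². For the potential term Φ = f², p = 2 and μ =
V(|x|) dx. Membership in L²(V dx) is not immediate, because f(t)² grows only linearly at infinity,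
so ∫ V f(u)² does not control ∫ V u². Two consequences of finite radial energy repair this
(`exists_lintegral_sq_le`): near the origin V ≤ C/|x|² and Hardy's inequality apply; away from it u
is bounded in terms of its energy, and on bounded sets t² is comparable to f(t)² (`sq_le_chg_sq`).

For the nonlinear term Φ = G∘f and μ = K(|x|) dx. Since |f(t)| ≤ |t| and 0 < f' ≤ 1, the derivative
(g∘f)f' inherits both power bounds of g. The ball B_{R₂} is treated with the exponent q₁ and its
complement with q₂. The supremum over B_{R₁} passes to B_{R₂} because on the annulus between them K
is bounded and so is u (`exists_setLIntegral_ball_le`).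

Both radial estimates are proved for one-dimensional profiles, then for test functions in polar
coordinates, and pass to the closure along sequences converging almost everywhere. -/

namespace OrliczSobolev

/-! ### Superposition operators from L^p to the dual space. -/

section Superposition

variable {α : Type*} [MeasurableSpace α] {μ : Measure α} {p p' : ℝ}

/-- A function dominated by the power `p - 1` of a function in `L^p` is in the dual space. -/
lemma memLp_of_abs_le_rpow (hp : p.HolderConjugate p') {C : ℝ} {m F : α → ℝ}
    (hm : MemLp m (ENNReal.ofReal p) μ) (hF : AEStronglyMeasurable F μ)
    (hb : ∀ x, |F x| ≤ C * |m x| ^ (p - 1)) : MemLp F (ENNReal.ofReal p') μ := by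
  have h := (hm.norm_rpow_div (ENNReal.ofReal (p - 1))).const_mul C
  rw [ENNReal.toReal_ofReal hp.sub_one_pos.le, ← ENNReal.ofReal_div_of_pos hp.sub_one_pos,
    ← hp.conjugate_eq] at h
  exact h.mono' hF (Eventually.of_forall fun x => by simpa using hb x)

/-- Since (p - 1)p' = p and |a| + |b| ≤ 2|a| + |b - a|, convexity of the power separates a term
depending on a alone from one that is small when b is close to a. This replaces a common majorant
along a sequence converging in L^p. -/
lemma enorm_rpow_le_of_growth (hp : p.HolderConjugate p') {C y a b : ℝ} (hC : 0 ≤ C)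
    (h : |y| ≤ C * (|a| + |b|) ^ (p - 1)) :
    ‖y‖ₑ ^ p' ≤ ENNReal.ofReal (C ^ p' * 2 ^ (p - 1)) *
      ((2 * ‖a‖ₑ) ^ p + ‖b - a‖ₑ ^ p) := by
  have hp0 := hp.pos
  have hp0' := hp.symm.pos
  have h1 : |y| ^ p' ≤ C ^ p' * (|a| + |b|) ^ p := by
    have := Real.rpow_le_rpow (abs_nonneg y) h hp0'.le
    rwa [Real.mul_rpow hC (by positivity), ← Real.rpow_mul (by positivity),
      hp.sub_one_mul_conj] at this
  have h2 : (|a| + |b|) ^ p ≤ (2 * |a| + |b - a|) ^ p := by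
    refine Real.rpow_le_rpow (by positivity) ?_ hp0.le
    have := abs_sub_abs_le_abs_sub b a
    linarith
  have h3 : ENNReal.ofReal ((2 * |a| + |b - a|) ^ p) ≤
      2 ^ (p - 1) * ((2 * ‖a‖ₑ) ^ p + ‖b - a‖ₑ ^ p) := by
    refine le_trans (le_of_eq ?_) (ENNReal.rpow_add_le_mul_rpow_add_rpow _ _ hp.lt.le)
    rw [← ENNReal.ofReal_rpow_of_nonneg (by positivity) hp0.le,
      ENNReal.ofReal_add (by positivity) (by positivity), ENNReal.ofReal_mul (by norm_num),
      Real.enorm_eq_ofReal_abs, Real.enorm_eq_ofReal_abs]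
    norm_num
  rw [Real.enorm_eq_ofReal_abs, ENNReal.ofReal_rpow_of_nonneg (abs_nonneg _) hp0'.le]
  refine (ENNReal.ofReal_le_ofReal (h1.trans (mul_le_mul_of_nonneg_left h2 (by positivity)))).trans ?_
  rw [ENNReal.ofReal_mul (by positivity), ENNReal.ofReal_mul (by positivity), mul_assoc]
  gcongr
  refine h3.trans_eq ?_
  rw [← ENNReal.ofReal_rpow_of_pos two_pos]
  norm_num

/-- Convergence to zero in the dual space of a superposition operator of two functions whose
kernel vanishes on the diagonal. -/
lemma tendsto_eLpNorm_superposition (hp : p.HolderConjugate p') [Fact (1 ≤ ENNReal.ofReal p)]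
    {Ψ : ℝ → ℝ → ℝ} (hm : Measurable (Function.uncurry Ψ)) {C : ℝ} (hC : 0 ≤ C)
    (hb : ∀ a b, |Ψ a b| ≤ C * (|a| + |b|) ^ (p - 1))
    (ht : ∀ a, Tendsto (Ψ a) (𝓝 a) (𝓝 0)) (w : Lp ℝ (ENNReal.ofReal p) μ) :
    Tendsto (fun v : Lp ℝ (ENNReal.ofReal p) μ =>
      eLpNorm (fun x => Ψ (w x) (v x)) (ENNReal.ofReal p') μ) (𝓝 w) (𝓝 0) := by
  have hp0 := hp.pos
  have hp0' := hp.symm.pos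
  have he : (ENNReal.ofReal p) ≠ 0 := by simpa using hp0
  have he' : (ENNReal.ofReal p') ≠ 0 := by simpa using hp0'
  -- Sequences suffice, and each may be thinned out to converge almost everywhere.
  refine tendsto_of_subseq_tendsto fun v hv => ?_
  obtain ⟨ns, hns, hae⟩ := (tendstoInMeasure_of_tendsto_Lp hv).exists_seq_tendsto_ae
  refine ⟨ns, ?_⟩
  have hv' := (Lp.tendsto_Lp_iff_tendsto_eLpNorm' _ _).1 (hv.comp hns.tendsto_atTop)
  set K : ℝ≥0∞ := ENNReal.ofReal (C ^ p' * 2 ^ (p - 1)) with hK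
  have hKt : K ≠ ⊤ := ENNReal.ofReal_ne_top
  have hmeas : ∀ u : Lp ℝ (ENNReal.ofReal p) μ,
      AEMeasurable (fun x => ‖Ψ (w x) (u x)‖ₑ ^ p') μ := fun u => by
    have : AEMeasurable (fun x => Ψ (w x) (u x)) μ :=
      hm.comp_aemeasurable ((Lp.aestronglyMeasurable w).aemeasurable.prodMk
        (Lp.aestronglyMeasurable u).aemeasurable)
    exact this.enorm.pow_const _
  -- The fixed integrable part of the growth bound. The truncation of the integrand at A converges
  -- by domination, and the excess over A is at most the other part, whose integral tends to 0 by
  -- L^p convergence.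
  set A : α → ℝ≥0∞ := fun x => K * (2 * ‖w x‖ₑ) ^ p with hA
  have hAm : AEMeasurable A μ :=
    (((Lp.aestronglyMeasurable w).enorm.const_mul 2).pow_const _).const_mul _
  have hAfin : ∫⁻ x, A x ∂μ ≠ ⊤ := by
    have h1 : ∀ x, A x = K * 2 ^ p * ‖w x‖ₑ ^ p := fun x => by
      rw [hA]
      simp only
      rw [ENNReal.mul_rpow_of_nonneg _ _ hp0.le, mul_assoc]
    simp only [h1]
    rw [lintegral_const_mul'' _ ((Lp.aestronglyMeasurable w).enorm.pow_const _)]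
    have h2 := lintegral_rpow_enorm_lt_top_of_eLpNorm_lt_top he ENNReal.ofReal_ne_top
      (Lp.eLpNorm_lt_top w)
    rw [ENNReal.toReal_ofReal hp0.le] at h2
    exact ENNReal.mul_ne_top (ENNReal.mul_ne_top hKt (by simp)) h2.ne
  have hB : Tendsto (fun n => ∫⁻ x, K * ‖v (ns n) x - w x‖ₑ ^ p ∂μ) atTop (𝓝 0) := by
    have h1 : ∀ n, ∫⁻ x, K * ‖v (ns n) x - w x‖ₑ ^ p ∂μ =
        K * eLpNorm (v (ns n) - w : α → ℝ) (ENNReal.ofReal p) μ ^ p := fun n => by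
      have h0 : AEMeasurable (fun x => ‖v (ns n) x - w x‖ₑ ^ p) μ :=
        ((Lp.aestronglyMeasurable _).sub (Lp.aestronglyMeasurable w)).enorm.pow_const _
      rw [lintegral_const_mul'' _ h0,
        eLpNorm_eq_lintegral_rpow_enorm_toReal he ENNReal.ofReal_ne_top,
        ENNReal.toReal_ofReal hp0.le, ← ENNReal.rpow_mul, one_div_mul_cancel hp0.ne',
        ENNReal.rpow_one]
      rfl
    simp only [h1]
    have h2 := ((ENNReal.continuous_rpow_const (y := p)).tendsto 0).comp hv'
    rw [ENNReal.zero_rpow_of_pos hp0] at h2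
    have h3 := ENNReal.Tendsto.const_mul h2 (Or.inr hKt)
    rwa [mul_zero] at h3
  have hmin : Tendsto (fun n => ∫⁻ x, min (‖Ψ (w x) (v (ns n) x)‖ₑ ^ p') (A x) ∂μ) atTop
      (𝓝 0) := by
    rw [← lintegral_zero (μ := μ)]
    refine tendsto_lintegral_of_dominated_convergence' A (fun n => (hmeas _).min hAm)
      (fun n => Eventually.of_forall fun x => min_le_right _ _) hAfin ?_
    filter_upwards [hae] with x hx
    have h1 := ((ht (w x)).comp hx).enorm
    rw [enorm_zero] at h1
    have h2 := ((ENNReal.continuous_rpow_const (y := p')).tendsto 0).comp h1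
    rw [ENNReal.zero_rpow_of_pos hp0'] at h2
    exact tendsto_of_tendsto_of_tendsto_of_le_of_le tendsto_const_nhds h2
      (fun _ => zero_le) (fun _ => min_le_left _ _)
  have hsum : Tendsto (fun n => ∫⁻ x, ‖Ψ (w x) (v (ns n) x)‖ₑ ^ p' ∂μ) atTop (𝓝 0) := by
    have h := hmin.add hB
    rw [add_zero] at h
    refine tendsto_of_tendsto_of_tendsto_of_le_of_le tendsto_const_nhds h
      (fun _ => zero_le) (fun n => ?_)
    simp only
    rw [← lintegral_add_left' ((hmeas _).min hAm)]
    refine lintegral_mono fun x => ?_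
    have h1 := enorm_rpow_le_of_growth hp hC (hb (w x) (v (ns n) x))
    rw [← hK, mul_add] at h1
    rcases min_choice (‖Ψ (w x) (v (ns n) x)‖ₑ ^ p') (A x) with h2 | h2
    · simp only [h2]
      exact le_self_add
    · simp only [h2]
      exact h1
  have h := ((ENNReal.continuous_rpow_const (y := 1 / p')).tendsto 0).comp hsum
  rw [ENNReal.zero_rpow_of_pos (by positivity)] at h
  refine h.congr fun n => ?_
  rw [eLpNorm_eq_lintegral_rpow_enorm_toReal he' ENNReal.ofReal_ne_top,
    ENNReal.toReal_ofReal hp0'.le]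
  rfl

end Superposition

/-! ### Differentiability of integral functionals on L^p. -/

section IntegralFunctional

variable {α : Type*} [MeasurableSpace α] {μ : Measure α} {p p' C : ℝ} {φ Φ : ℝ → ℝ}

/-- Mean value inequality: every t between a and b satisfies |t| ≤ |a| + |b|. -/
lemma abs_sub_le_of_growth (hp : 1 < p) (hC : 0 ≤ C) (hΦ : ∀ t, HasDerivAt Φ (φ t) t)
    (hb : ∀ t, |φ t| ≤ C * |t| ^ (p - 1)) (a b : ℝ) :
    |Φ b - Φ a| ≤ C * (|a| + |b|) ^ (p - 1) * |b - a| := by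
  refine (convex_uIcc a b).norm_image_sub_le_of_norm_hasDerivWithin_le
    (fun t _ => (hΦ t).hasDerivWithinAt) (fun t ht => ?_) left_mem_uIcc right_mem_uIcc
  refine (hb t).trans ?_
  have h : |t| ≤ |a| + |b| := by
    rcases mem_uIcc.1 ht with ⟨h1, h2⟩ | ⟨h1, h2⟩ <;>
    · rw [abs_le]
      constructor <;>
      linarith [neg_abs_le a, neg_abs_le b, le_abs_self a, le_abs_self b, abs_nonneg a,
        abs_nonneg b]
  have : 0 ≤ p - 1 := by linarith
  gcongr

lemma integrable_comp_of_growth (hp : p.HolderConjugate p') (hC : 0 ≤ C)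
    (hΦ : ∀ t, HasDerivAt Φ (φ t) t) (hΦ0 : Φ 0 = 0) (hb : ∀ t, |φ t| ≤ C * |t| ^ (p - 1))
    {w : α → ℝ} (hw : MemLp w (ENNReal.ofReal p) μ) : Integrable (fun x => Φ (w x)) μ := by
  have hc : Continuous Φ := continuous_iff_continuousAt.2 fun t => (hΦ t).continuousAt
  have h := hw.integrable_norm_rpow (by simpa using hp.pos) ENNReal.ofReal_ne_top
  rw [ENNReal.toReal_ofReal hp.nonneg] at h
  refine (h.const_mul C).mono' (hc.comp_aestronglyMeasurable hw.1)
    (Eventually.of_forall fun x => ?_)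
  have h1 := abs_sub_le_of_growth hp.lt hC hΦ hb 0 (w x)
  rw [hΦ0, sub_zero, sub_zero, abs_zero, zero_add, mul_assoc] at h1
  refine h1.trans (le_of_eq ?_)
  rw [Real.norm_eq_abs]
  -- Merging |w|^(p-1) · |w| into |w|^p by `Real.rpow_add_one` needs a nonzero base.
  rcases (abs_nonneg (w x)).eq_or_lt with h0 | h0
  · rw [← h0, mul_zero, Real.zero_rpow hp.ne_zero]
  · rw [← Real.rpow_add_one h0.ne', sub_add_cancel]

lemma memLp_deriv_comp (hp : p.HolderConjugate p') (hφ : Continuous φ)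
    (hb : ∀ t, |φ t| ≤ C * |t| ^ (p - 1)) {w : α → ℝ} (hw : MemLp w (ENNReal.ofReal p) μ) :
    MemLp (fun x => φ (w x)) (ENNReal.ofReal p') μ :=
  memLp_of_abs_le_rpow hp hw (hφ.comp_aestronglyMeasurable hw.1) fun _ => hb _

/-- The remainder of the first order Taylor expansion of `Φ`, divided by the increment. -/
noncomputable def taylorQuotient (φ Φ : ℝ → ℝ) (a b : ℝ) : ℝ := (Φ b - Φ a - φ a * (b - a)) / (b - a)

/-- On the diagonal the quotient is 0 by the convention for division by zero, and both sides vanish.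
-/
lemma taylorQuotient_mul (a b : ℝ) :
    taylorQuotient φ Φ a b * (b - a) = Φ b - Φ a - φ a * (b - a) := by
  rcases eq_or_ne b a with rfl | h
  · simp
  · exact div_mul_cancel₀ _ (sub_ne_zero.2 h)

/-- The increment of Φ and the linear term each contribute one constant C. Dividing out b - a leaves
growth of order p - 1, which is what places the quotient in the dual space. -/
lemma abs_taylorQuotient_le (hp : 1 < p) (hC : 0 ≤ C) (hΦ : ∀ t, HasDerivAt Φ (φ t) t)
    (hb : ∀ t, |φ t| ≤ C * |t| ^ (p - 1)) (a b : ℝ) :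
    |taylorQuotient φ Φ a b| ≤ 2 * C * (|a| + |b|) ^ (p - 1) := by
  rcases eq_or_ne b a with rfl | h
  · simp only [taylorQuotient, sub_self, div_zero, abs_zero]
    positivity
  have h0 : 0 < |b - a| := abs_pos.2 (sub_ne_zero.2 h)
  rw [taylorQuotient, abs_div, div_le_iff₀ h0]
  have h1 := abs_sub_le_of_growth hp hC hΦ hb a b
  have h2 : |φ a| ≤ C * (|a| + |b|) ^ (p - 1) := by
    refine (hb a).trans ?_
    have : 0 ≤ p - 1 := by linarith
    gcongr
    linarith [abs_nonneg b]
  have h3 : |φ a * (b - a)| ≤ C * (|a| + |b|) ^ (p - 1) * |b - a| := by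
    rw [abs_mul]
    gcongr
  have h4 := abs_sub (Φ b - Φ a) (φ a * (b - a))
  linarith

/-- This is differentiability of Φ at a. The neighbourhood need not be punctured, since the quotient
is 0 at b = a. -/
lemma tendsto_taylorQuotient (hΦ : ∀ t, HasDerivAt Φ (φ t) t) (a : ℝ) :
    Tendsto (taylorQuotient φ Φ a) (𝓝 a) (𝓝 0) := by
  have h := hasDerivAt_iff_tendsto.1 (hΦ a)
  refine squeeze_zero_norm (fun b => le_of_eq ?_) h
  rw [taylorQuotient, norm_div, smul_eq_mul, mul_comm (b - a), div_eq_inv_mul]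

/-- Integral functionals of functions with derivative of growth `|t|^(p-1)` are differentiable
on `L^p`, with continuous derivative given by the pairing with `φ ∘ w`. -/
theorem exists_hasFDerivAt_integral_comp (hp : p.HolderConjugate p')
    [Fact (1 ≤ ENNReal.ofReal p)] (hC : 0 ≤ C)
    (hφ : Continuous φ) (hΦ : ∀ t, HasDerivAt Φ (φ t) t) (hΦ0 : Φ 0 = 0)
    (hb : ∀ t, |φ t| ≤ C * |t| ^ (p - 1)) :
    ∃ L : Lp ℝ (ENNReal.ofReal p) μ → (Lp ℝ (ENNReal.ofReal p) μ →L[ℝ] ℝ), Continuous L ∧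
      (∀ w, HasFDerivAt (fun v : Lp ℝ (ENNReal.ofReal p) μ => ∫ x, Φ (v x) ∂μ) (L w) w) ∧
      ∀ w h, L w h = ∫ x, φ (w x) * h x ∂μ := by
  have : (ENNReal.ofReal p').HolderConjugate (ENNReal.ofReal p) := hp.symm.ennrealOfReal
  have hF : Fact (1 ≤ ENNReal.ofReal p') :=
    ⟨ENNReal.HolderConjugate.one_le _ (ENNReal.ofReal p)⟩
  have hcΦ : Continuous Φ := continuous_iff_continuousAt.2 fun t => (hΦ t).continuousAt
  have hp1 : 0 ≤ p - 1 := hp.sub_one_pos.le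
  let B := (ContinuousLinearMap.mul ℝ ℝ).lpPairing μ (ENNReal.ofReal p') (ENNReal.ofReal p)
  have hB : ∀ (f : α → ℝ) (hf : MemLp f (ENNReal.ofReal p') μ) (h : Lp ℝ (ENNReal.ofReal p) μ),
      B (hf.toLp f) h = ∫ x, f x * h x ∂μ := fun f hf h => by
    rw [ContinuousLinearMap.lpPairing_eq_integral]
    apply integral_congr_ae
    filter_upwards [hf.coeFn_toLp] with x hx
    rw [hx, ContinuousLinearMap.mul_apply']
  have hmem : ∀ w : Lp ℝ (ENNReal.ofReal p) μ, MemLp (fun x => φ (w x)) (ENNReal.ofReal p') μ :=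
    fun w => memLp_deriv_comp hp hφ hb (Lp.memLp w)
  refine ⟨fun w => B ((hmem w).toLp _), B.continuous.comp ?_, fun w => ?_,
    fun w h => hB _ _ _⟩
  · refine continuous_iff_continuousAt.2 fun w => ?_
    refine (Lp.tendsto_Lp_iff_tendsto_eLpNorm'' _ hmem _ (hmem w)).2 ?_
    -- Continuity of w ↦ φ∘w: the kernel φ(b) - φ(a) vanishes on the diagonal.
    refine tendsto_eLpNorm_superposition (Ψ := fun a b => φ b - φ a) hp
      (by fun_prop) (C := 2 * C) (by positivity) (fun a b => ?_) (fun a => ?_) w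
    · have h1 : |φ a| ≤ C * (|a| + |b|) ^ (p - 1) :=
        (hb a).trans (by gcongr; linarith [abs_nonneg b])
      have h2 : |φ b| ≤ C * (|a| + |b|) ^ (p - 1) :=
        (hb b).trans (by gcongr; linarith [abs_nonneg a])
      have h3 := abs_sub (φ b) (φ a)
      linarith
    · have h := (hφ.tendsto a).sub_const (φ a)
      rwa [sub_self] at h
  · rw [hasFDerivAt_iff_tendsto]
    have hm : Measurable (Function.uncurry (taylorQuotient φ Φ)) := by
      unfold taylorQuotient Function.uncurry
      have h1 := hcΦ.measurable
      have h2 := hφ.measurable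
      fun_prop
    have hq : ∀ v : Lp ℝ (ENNReal.ofReal p) μ,
        MemLp (fun x => taylorQuotient φ Φ (w x) (v x)) (ENNReal.ofReal p') μ := fun v => by
      refine memLp_of_abs_le_rpow (C := 2 * C) (m := fun x => |w x| + |v x|) hp
        ((Lp.memLp w).abs.add (Lp.memLp v).abs) ?_ (fun x => ?_)
      · exact (hm.comp_aemeasurable ((Lp.aestronglyMeasurable w).aemeasurable.prodMk
          (Lp.aestronglyMeasurable v).aemeasurable)).aestronglyMeasurable
      · rw [abs_of_nonneg (by positivity : 0 ≤ |w x| + |v x|)]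
        exact abs_taylorQuotient_le hp.lt hC hΦ hb _ _
    have ht := tendsto_eLpNorm_superposition hp hm (C := 2 * C) (by positivity)
      (abs_taylorQuotient_le hp.lt hC hΦ hb) (tendsto_taylorQuotient hΦ) w
    have ht' : Tendsto (fun v => ‖B‖ * ‖(hq v).toLp _‖) (𝓝 w) (𝓝 0) := by
      have h := ((ENNReal.tendsto_toReal ENNReal.zero_ne_top).comp ht).const_mul ‖B‖
      rw [ENNReal.toReal_zero, mul_zero] at h
      refine h.congr fun v => ?_
      rw [Lp.norm_toLp]
      rfl
    refine squeeze_zero (fun v => by positivity) (fun v => ?_) ht'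
    -- The Taylor remainder is exactly the pairing of the quotient with v - w, hence at most ‖B‖ ‖v
    -- - w‖ times the dual norm of the quotient.
    have hid : (∫ x, Φ (v x) ∂μ) - (∫ x, Φ (w x) ∂μ) - B ((hmem w).toLp _) (v - w) =
        B ((hq v).toLp _) (v - w) := by
      rw [hB, hB, ← integral_sub (integrable_comp_of_growth hp hC hΦ hΦ0 hb (Lp.memLp v))
        (integrable_comp_of_growth hp hC hΦ hΦ0 hb (Lp.memLp w)), ← integral_sub]
      · apply integral_congr_ae
        filter_upwards [Lp.coeFn_sub v w] with x hx
        rw [hx, Pi.sub_apply, taylorQuotient_mul]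
      · exact (integrable_comp_of_growth hp hC hΦ hΦ0 hb (Lp.memLp v)).sub
          (integrable_comp_of_growth hp hC hΦ hΦ0 hb (Lp.memLp w))
      · exact (hmem w).integrable_mul (Lp.memLp (v - w))
    rw [hid]
    have h1 := B.le_opNorm₂ ((hq v).toLp _) (v - w)
    rcases eq_or_ne (v - w) 0 with h0 | h0
    · rw [h0, norm_zero, inv_zero, zero_mul]
      positivity
    · rw [inv_mul_le_iff₀ (norm_pos_iff.2 h0)]
      linarith

end IntegralFunctional

/-! ### One-dimensional estimates for radial profiles. -/

section Profile

variable {ψ ψ' : ℝ → ℝ} {R : ℝ}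

/-- One-dimensional Hardy inequality for profiles vanishing on `[R, ∞)`. -/
lemma integral_pow_mul_sq_le (n : ℕ) (hψ : ∀ r, HasDerivAt ψ (ψ' r) r) (hc : Continuous ψ')
    (hR : 0 ≤ R) (h0 : ψ R = 0) :
    ∫ r in (0 : ℝ)..R, r ^ n * ψ r ^ 2 ≤ 4 * ∫ r in (0 : ℝ)..R, r ^ (n + 2) * ψ' r ^ 2 := by
  have hcψ : Continuous ψ := continuous_iff_continuousAt.2 fun t => (hψ t).continuousAt
  have hd : ∀ r ∈ uIcc 0 R, HasDerivAt (fun r => r ^ (n + 1) * ψ r ^ 2)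
      ((n + 1) * (r ^ n * ψ r ^ 2) + r ^ (n + 1) * (2 * ψ r * ψ' r)) r := fun r _ => by
    have h : HasDerivAt (fun r => r ^ (n + 1) * ψ r ^ 2) _ r :=
      (hasDerivAt_pow (n + 1) r).mul ((hψ r).pow 2)
    refine h.congr_deriv ?_
    push_cast
    simp only [pow_one]
    ring
  have hi : IntervalIntegrable (fun r => (n + 1) * (r ^ n * ψ r ^ 2) +
      r ^ (n + 1) * (2 * ψ r * ψ' r)) volume 0 R :=
    Continuous.intervalIntegrable (by fun_prop) _ _
  -- Both boundary values of r^(n+1) ψ² vanish: at 0 by the power, at R by ψ(R) = 0.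
  have hftc := intervalIntegral.integral_eq_sub_of_hasDerivAt hd hi
  simp only [h0, ne_eq, Nat.succ_ne_zero, not_false_eq_true, zero_pow, zero_mul, mul_zero,
    OfNat.ofNat_ne_zero, sub_zero] at hftc
  -- The cross term is bounded below by expanding r^n (ψ + 2rψ')² ≥ 0. Keeping only half of the n +
  -- 1 copies of r^n ψ² gives the constant 4 for every n, instead of the sharper 4/(n+1)².
  have hmono := intervalIntegral.integral_mono_on (μ := volume) hR
    (f := fun r => 2⁻¹ * (r ^ n * ψ r ^ 2) - 2 * (r ^ (n + 2) * ψ' r ^ 2))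
    (Continuous.intervalIntegrable (by fun_prop) _ _) hi (fun r hr => by
      have hr0 : 0 ≤ r := hr.1
      have h1 : 0 ≤ r ^ n * (ψ r + 2 * r * ψ' r) ^ 2 := by positivity
      have h2 : 0 ≤ n * (r ^ n * ψ r ^ 2) := by positivity
      have h3 : r ^ n * (ψ r + 2 * r * ψ' r) ^ 2 = r ^ n * ψ r ^ 2 +
          2 * (r ^ (n + 1) * (2 * ψ r * ψ' r)) + 4 * (r ^ (n + 2) * ψ' r ^ 2) := by ring
      linarith)
  rw [hftc, intervalIntegral.integral_sub (Continuous.intervalIntegrable (by fun_prop) _ _)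
    (Continuous.intervalIntegrable (by fun_prop) _ _), intervalIntegral.integral_const_mul,
    intervalIntegral.integral_const_mul] at hmono
  linarith

/-- Pointwise bound away from the origin for profiles vanishing on `[R, ∞)`. -/
lemma abs_profile_le (n : ℕ) (hψ : ∀ r, HasDerivAt ψ (ψ' r) r) (hc : Continuous ψ')
    (hR : 0 ≤ R) (h0 : ∀ r, R ≤ r → ψ r = 0) {ρ r : ℝ} (hρ : 0 < ρ) (hr : ρ ≤ r) :
    |ψ r| ≤ (ρ ^ n)⁻¹ * (∫ s in (0 : ℝ)..R, s ^ (n + 2) * ψ' s ^ 2) + ρ⁻¹ := by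
  have hr0 : 0 < r := hρ.trans_le hr
  have hnn : 0 ≤ ∫ s in (0 : ℝ)..R, s ^ (n + 2) * ψ' s ^ 2 :=
    intervalIntegral.integral_nonneg hR fun s hs => by have := hs.1; positivity
  rcases le_total R r with hRr | hRr
  · rw [h0 r hRr, abs_zero]
    positivity
  have hftc := intervalIntegral.integral_eq_sub_of_hasDerivAt (fun s _ => hψ s)
    (hc.intervalIntegrable r R)
  rw [h0 R le_rfl, zero_sub] at hftc
  have hinv : ∀ s ∈ uIcc r R, HasDerivAt (fun s : ℝ => -s⁻¹) (s ^ 2)⁻¹ s := fun s hs => by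
    rw [uIcc_of_le hRr] at hs
    have hs0 : s ≠ 0 := (hr0.trans_le hs.1).ne'
    exact (hasDerivAt_inv hs0).fun_neg.congr_deriv (neg_neg _)
  have hcinv : ContinuousOn (fun s : ℝ => (s ^ 2)⁻¹) (uIcc r R) := by
    rw [uIcc_of_le hRr]
    exact (by fun_prop : ContinuousOn (fun s : ℝ => s ^ 2) _).inv₀ fun s hs =>
      pow_ne_zero _ (hr0.trans_le hs.1).ne'
  have hftc' := intervalIntegral.integral_eq_sub_of_hasDerivAt hinv hcinv.intervalIntegrable
  have hcpow : Continuous (fun s => (ρ ^ n)⁻¹ * (s ^ (n + 2) * ψ' s ^ 2)) := by fun_prop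
  -- Expanding (s|ψ'| - 1/s)² ≥ 0 bounds |ψ'| by s²ψ'² + s⁻², and s² ≤ ρ^(-n) s^(n+2) for s ≥ ρ. The
  -- resulting bound is affine in the energy rather than a square root, which is enough on the unit
  -- ball.
  have hmono : ∫ s in r..R, |ψ' s| ≤
      ∫ s in r..R, ((ρ ^ n)⁻¹ * (s ^ (n + 2) * ψ' s ^ 2) + (s ^ 2)⁻¹) := by
    refine intervalIntegral.integral_mono_on hRr (hc.abs.intervalIntegrable _ _)
      ((hcpow.intervalIntegrable _ _).add hcinv.intervalIntegrable) fun s hs => ?_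
    have hs0 : 0 < s := hr0.trans_le hs.1
    have h1 : ρ ^ n ≤ s ^ n := pow_le_pow_left₀ hρ.le (hr.trans hs.1) n
    have h2 : s ^ 2 * ψ' s ^ 2 ≤ (ρ ^ n)⁻¹ * (s ^ (n + 2) * ψ' s ^ 2) := by
      rw [inv_mul_eq_div, le_div_iff₀ (by positivity), pow_add]
      nlinarith [mul_le_mul_of_nonneg_right h1 (by positivity : 0 ≤ s ^ 2 * ψ' s ^ 2)]
    have h3 : 0 ≤ (s * |ψ' s| - s⁻¹) ^ 2 := sq_nonneg _
    have h4 : (s * |ψ' s| - s⁻¹) ^ 2 = s ^ 2 * ψ' s ^ 2 - 2 * |ψ' s| + (s ^ 2)⁻¹ := by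
      rw [sub_sq, mul_pow, sq_abs, inv_pow]
      field_simp
    linarith [abs_nonneg (ψ' s)]
  rw [intervalIntegral.integral_add (hcpow.intervalIntegrable _ _) hcinv.intervalIntegrable,
    hftc', intervalIntegral.integral_const_mul] at hmono
  have hsub : ∫ s in r..R, s ^ (n + 2) * ψ' s ^ 2 ≤ ∫ s in (0 : ℝ)..R, s ^ (n + 2) * ψ' s ^ 2 := by
    refine intervalIntegral.integral_mono_interval hr0.le hRr le_rfl ?_
      (Continuous.intervalIntegrable (by fun_prop) _ _)
    filter_upwards [ae_restrict_mem measurableSet_Ioc] with s hs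
    have := hs.1
    simp only [Pi.zero_apply]
    positivity
  have hle : |ψ r| ≤ ∫ s in r..R, |ψ' s| := by
    rw [← abs_neg, ← hftc]
    exact intervalIntegral.abs_integral_le_integral_abs hRr
  have hsub' := mul_le_mul_of_nonneg_left hsub (by positivity : 0 ≤ (ρ ^ n)⁻¹)
  have hrρ : r⁻¹ ≤ ρ⁻¹ := inv_anti₀ hρ hr
  have hRinv : 0 ≤ R⁻¹ := inv_nonneg.2 hR
  linarith

end Profile

/-! ### Hardy inequality and pointwise bound for radial test functions. -/

section RadialTest

variable {N : ℕ} {φ : Rn N → ℝ}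

/-- The radial profile of a radial test function. -/
lemma IsRadialTest.exists_profile [Nontrivial (Rn N)] (hφ : IsRadialTest φ) :
    ∃ (ψ ψ' : ℝ → ℝ) (R : ℝ), (∀ r, HasDerivAt ψ (ψ' r) r) ∧ Continuous ψ' ∧ 0 < R ∧
      (∀ r, R ≤ r → ψ r = 0) ∧ (∀ r, R ≤ r → ψ' r = 0) ∧
      (∀ x, φ x = ψ ‖x‖) ∧ ∀ x ≠ 0, |ψ' ‖x‖| ≤ ‖∇ φ x‖ := by
  obtain ⟨e, he⟩ : ∃ e : Rn N, ‖e‖ = 1 := exists_norm_eq (Rn N) zero_le_one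
  have hdφ : Differentiable ℝ φ := hφ.smooth.differentiable (by simp)
  have hd : ∀ r : ℝ, HasDerivAt (fun r : ℝ => φ (r • e)) (fderiv ℝ φ (r • e) e) r := fun r => by
    have h1 : HasDerivAt (fun r : ℝ => r • e) e r := by
      simpa using (hasDerivAt_id r).smul_const e
    exact (hdφ (r • e)).hasFDerivAt.comp_hasDerivAt r h1
  obtain ⟨R, hR, hsub⟩ := hφ.compactSupport.isCompact.isBounded.subset_ball_lt 0 0
  have hcf : Continuous (fderiv ℝ φ) := hφ.smooth.continuous_fderiv (by simp)
  have hout : ∀ r, R ≤ r → r • e ∉ tsupport φ := fun r hr h => by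
    have h1 := hsub h
    rw [mem_ball_zero_iff, norm_smul, he, mul_one, Real.norm_eq_abs] at h1
    linarith [le_abs_self r]
  refine ⟨fun r => φ (r • e), fun r => fderiv ℝ φ (r • e) e, R, hd, by fun_prop, hR,
    fun r hr => image_eq_zero_of_notMem_tsupport (hout r hr), fun r hr => ?_,
    fun x => hφ.radial _ _ ?_, fun x hx => ?_⟩
  · simp [fderiv_of_notMem_tsupport ℝ (hout r hr)]
  · rw [norm_smul, he, mul_one, norm_norm]
  · have hx0 : 0 < ‖x‖ := norm_pos_iff.2 hx
    -- By radiality the profile along the direction v of x is the profile along e, so its derivative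
    -- at ‖x‖ is the derivative of φ at x in the unit direction v.
    set v : Rn N := ‖x‖⁻¹ • x with hv
    have hvn : ‖v‖ = 1 := by
      rw [hv, norm_smul, norm_inv, norm_norm, inv_mul_cancel₀ hx0.ne']
    have hxv : x = ‖x‖ • v := by rw [hv, smul_inv_smul₀ hx0.ne']
    have h1 : HasDerivAt (fun r : ℝ => φ (r • v)) (fderiv ℝ φ x v) ‖x‖ := by
      have h2 : HasDerivAt (fun r : ℝ => r • v) v ‖x‖ := by
        simpa using (hasDerivAt_id ‖x‖).smul_const v
      have h3 := (hdφ (‖x‖ • v)).hasFDerivAt.comp_hasDerivAt ‖x‖ h2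
      rwa [← hxv] at h3
    have h4 : (fun r : ℝ => φ (r • v)) = fun r : ℝ => φ (r • e) := by
      funext r
      apply hφ.radial
      rw [norm_smul r v, norm_smul r e, he, hvn]
    rw [h4] at h1
    simp only
    rw [(hd ‖x‖).unique h1, ← inner_gradient_left]
    refine (abs_real_inner_le_norm _ _).trans ?_
    rw [hvn, mul_one]

/-- Polar coordinates: N|B₁| is the area of the unit sphere, and the radial integral stops at R. -/
lemma integral_fun_norm_eq [Nontrivial (Rn N)] {R : ℝ} (hR : 0 ≤ R) {F : ℝ → ℝ}
    (hF : ∀ r, R ≤ r → F r = 0) :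
    ∫ x : Rn N, F ‖x‖ = (N * volume.real (Metric.ball (0 : Rn N) 1)) *
      ∫ r in (0 : ℝ)..R, r ^ (N - 1) * F r := by
  rw [integral_fun_norm_addHaar, finrank_euclideanSpace_fin, nsmul_eq_mul, smul_eq_mul, mul_assoc,
    intervalIntegral.integral_of_le hR]
  congr 2
  simp only [smul_eq_mul]
  refine (setIntegral_eq_of_subset_of_forall_sdiff_eq_zero measurableSet_Ioi
    Ioc_subset_Ioi_self fun r hr => ?_)
  have h : R ≤ r := by
    by_contra! h
    exact hr.2 ⟨hr.1, h.le⟩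
  rw [hF r h, mul_zero]

/-- Transfers the one-dimensional weighted energy to the Dirichlet energy; the excluded origin is a
null set. -/
lemma IsRadialTest.integral_profile_le [Nontrivial (Rn N)] (hφ : IsRadialTest φ) {ψ' : ℝ → ℝ}
    {R : ℝ} (hR : 0 ≤ R) (hψ' : ∀ r, R ≤ r → ψ' r = 0) (h : ∀ x ≠ 0, |ψ' ‖x‖| ≤ ‖∇ φ x‖) :
    (N * volume.real (Metric.ball (0 : Rn N) 1)) * (∫ r in (0 : ℝ)..R, r ^ (N - 1) * ψ' r ^ 2) ≤
      ∫ x, ‖∇ φ x‖ ^ 2 := by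
  rw [← integral_fun_norm_eq hR (F := fun r => ψ' r ^ 2) fun r hr => by simp [hψ' r hr]]
  refine integral_mono_of_nonneg (Eventually.of_forall fun x => sq_nonneg _) ?_ ?_
  · have h1 : Continuous fun x => ‖∇ φ x‖ ^ 2 := (continuous_gradient hφ.smooth).norm.pow 2
    have h2 : HasCompactSupport fun x => ‖∇ φ x‖ ^ 2 := by
      refine (hasCompactSupport_gradient hφ.compactSupport).mono fun x hx h3 => hx ?_
      simp only
      rw [h3, norm_zero, zero_pow two_ne_zero]
    exact h1.integrable_of_hasCompactSupport h2
  · filter_upwards [compl_mem_ae_iff.2 (measure_singleton (0 : Rn N))] with x hx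
    exact sq_le_sq.2 ((h x hx).trans (le_abs_self _))

instance nontrivial_Rn [h : Fact (3 ≤ N)] : Nontrivial (Rn N) := by
  apply Module.nontrivial_of_finrank_pos (R := ℝ)
  rw [finrank_euclideanSpace_fin]
  have := h.out
  omega

lemma sphere_factor_pos [h : Fact (3 ≤ N)] :
    0 < N * volume.real (Metric.ball (0 : Rn N) 1) := by
  have h3 : (0 : ℝ) < N := by exact_mod_cast (by have := h.out; omega : 0 < N)
  have : 0 < volume.real (Metric.ball (0 : Rn N) 1) :=
    ENNReal.toReal_pos (Metric.measure_ball_pos _ _ one_pos).ne' measure_ball_lt_top.ne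
  positivity

/-- Radial test functions are bounded away from the origin in terms of their energy. -/
lemma exists_radial_bound (N : ℕ) [Fact (3 ≤ N)] {ρ : ℝ} (hρ : 0 < ρ) :
    ∃ A : ℝ, 0 ≤ A ∧ ∀ φ : Rn N → ℝ, IsRadialTest φ → ∀ x, ρ ≤ ‖x‖ →
      |φ x| ≤ A * (∫ y, ‖∇ φ y‖ ^ 2) + ρ⁻¹ := by
  set κ := N * volume.real (Metric.ball (0 : Rn N) 1) with hκ
  have hκ0 : 0 < κ := sphere_factor_pos
  -- With N = 3 + n, the polar weight r^(N-1) is the weight r^(n+2) of the profile estimates.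
  obtain ⟨n, hn⟩ := Nat.exists_eq_add_of_le (Fact.out : 3 ≤ N)
  refine ⟨(ρ ^ n)⁻¹ * κ⁻¹, by positivity, fun φ hφ x hx => ?_⟩
  obtain ⟨ψ, ψ', R, hψ, hc, hR, h0, h0', hφψ, hle⟩ := hφ.exists_profile
  have h1 := hφ.integral_profile_le hR.le h0' hle
  rw [show N - 1 = n + 2 by omega, ← hκ, ← le_inv_mul_iff₀ hκ0] at h1
  have h2 := abs_profile_le n hψ hc hR.le h0 hρ hx
  have h3 := mul_le_mul_of_nonneg_left h1 (by positivity : 0 ≤ (ρ ^ n)⁻¹)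
  rw [hφψ, mul_assoc]
  linarith

/-- Hardy inequality for radial test functions. -/
lemma IsRadialTest.lintegral_hardy [Fact (3 ≤ N)] (hφ : IsRadialTest φ) :
    ∫⁻ x, ENNReal.ofReal (φ x ^ 2 / ‖x‖ ^ 2) ≤ ENNReal.ofReal (4 * ∫ y, ‖∇ φ y‖ ^ 2) := by
  obtain ⟨n, hn⟩ := Nat.exists_eq_add_of_le (Fact.out : 3 ≤ N)
  obtain ⟨ψ, ψ', R, hψ, hc, hR, h0, h0', hφψ, hle⟩ := hφ.exists_profile
  have hcψ : Continuous ψ := continuous_iff_continuousAt.2 fun t => (hψ t).continuousAt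
  have hpow : ∀ r : ℝ, 0 < r → r ^ (N - 1) * (ψ r ^ 2 / r ^ 2) = r ^ n * ψ r ^ 2 := fun r hr => by
    rw [show N - 1 = n + 2 by omega, pow_add]
    field_simp
  -- In polar coordinates the singular weight is absorbed: the radial integrand r^n ψ² is continuous
  -- up to 0 and vanishes beyond R.
  have hint : Integrable (fun x : Rn N => ψ ‖x‖ ^ 2 / ‖x‖ ^ 2) := by
    rw [integrable_fun_norm_addHaar volume (f := fun r => ψ r ^ 2 / r ^ 2),
      finrank_euclideanSpace_fin]
    simp only [smul_eq_mul]
    rw [integrableOn_congr_fun (g := fun r => r ^ n * ψ r ^ 2) (s := Ioi 0)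
      (fun r hr => hpow r hr) measurableSet_Ioi]
    refine IntegrableOn.of_forall_sdiff_eq_zero (s := Icc 0 R)
      (Continuous.integrableOn_Icc (by fun_prop)) measurableSet_Ioi fun r hr => ?_
    have h : R ≤ r := by
      by_contra! h
      exact hr.2 ⟨(mem_Ioi.1 hr.1).le, h.le⟩
    rw [h0 r h]
    simp
  simp only [hφψ]
  rw [← ofReal_integral_eq_lintegral_ofReal hint (Eventually.of_forall fun x => by positivity)]
  refine ENNReal.ofReal_le_ofReal ?_
  rw [integral_fun_norm_eq hR.le (F := fun r => ψ r ^ 2 / r ^ 2) fun r hr => by simp [h0 r hr]]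
  have h1 := hφ.integral_profile_le hR.le h0' hle
  have h2 := integral_pow_mul_sq_le n hψ hc hR.le (h0 R le_rfl)
  have h3 := mul_le_mul_of_nonneg_left h2 (sphere_factor_pos (N := N)).le
  rw [intervalIntegral.integral_congr_ae (g := fun r => r ^ n * ψ r ^ 2)
    (Eventually.of_forall fun r hr => hpow r (by rw [uIoc_of_le hR.le] at hr; exact hr.1))]
  rw [show N - 1 = n + 2 by omega] at h1
  linarith

end RadialTest

/-! ### Passage to the closure of the radial test functions. -/

section Closure

variable {N : ℕ}

lemma integral_norm_sq_eq (v : Lp (Rn N) 2 (volume : Measure (Rn N))) :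
    ∫ x, ‖v x‖ ^ 2 = ‖v‖ ^ 2 := by
  rw [← real_inner_self_eq_norm_sq, L2.inner_def]
  simp only [real_inner_self_eq_norm_sq]

variable [Fact (3 ≤ N)]

/-- Elements of `D_r^{1,2}(ℝᴺ)` are limits almost everywhere of radial test functions with
converging energies. -/
lemma exists_seq_radialTest {p : Pairs N} (hp : p ∈ DirichletRadial N) :
    ∃ φ : ℕ → Rn N → ℝ, (∀ n, IsRadialTest (φ n)) ∧
      (∀ᵐ x, Tendsto (fun n => φ n x) atTop (𝓝 (p.1 x))) ∧
      Tendsto (fun n => ∫ x, ‖∇ (φ n) x‖ ^ 2) atTop (𝓝 (‖p.2‖ ^ 2)) := by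
  obtain ⟨q, hq, hlim⟩ := mem_closure_iff_seq_limit.1 hp
  choose φ hφ h1 h2 using hq
  have hlim1 : Tendsto (fun n => (q n).1) atTop (𝓝 p.1) := (continuous_fst.tendsto p).comp hlim
  have hlim2 : Tendsto (fun n => (q n).2) atTop (𝓝 p.2) := (continuous_snd.tendsto p).comp hlim
  obtain ⟨ns, hns, hae⟩ := (tendstoInMeasure_of_tendsto_Lp hlim1).exists_seq_tendsto_ae
  refine ⟨fun n => φ (ns n), fun n => hφ _, ?_, ?_⟩
  · filter_upwards [hae, ae_all_iff.2 h1] with x hx hx1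
    simpa only [hx1] using hx
  · have h3 := ((hlim2.comp hns.tendsto_atTop).norm).pow 2
    refine h3.congr fun n => ?_
    rw [Function.comp_apply, ← integral_norm_sq_eq]
    apply integral_congr_ae
    filter_upwards [h2 (ns n)] with x hx
    rw [hx]

/-- Functions in the unit ball of `D_r^{1,2}(ℝᴺ)` are uniformly bounded away from the origin. -/
lemma exists_ae_bound (N : ℕ) [Fact (3 ≤ N)] {ρ : ℝ} (hρ : 0 < ρ) :
    ∃ M : ℝ, 0 ≤ M ∧ ∀ p ∈ DirichletRadial N, ‖p.2‖ ≤ 1 → ∀ᵐ x, ρ ≤ ‖x‖ → |p.1 x| ≤ M := by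
  obtain ⟨A, hA, h⟩ := exists_radial_bound N hρ
  refine ⟨A + ρ⁻¹, by positivity, fun p hp hp1 => ?_⟩
  obtain ⟨φ, hφ, hae, hlim⟩ := exists_seq_radialTest hp
  filter_upwards [hae] with x hx hρx
  have h1 := le_of_tendsto_of_tendsto' hx.abs ((hlim.const_mul A).add_const ρ⁻¹)
    fun n => h (φ n) (hφ n) x hρx
  have h2 : ‖p.2‖ ^ 2 ≤ 1 := pow_le_one₀ (norm_nonneg _) hp1
  have h3 := mul_le_mul_of_nonneg_left h2 hA
  linarith

/-- Hardy inequality in `D_r^{1,2}(ℝᴺ)`. -/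
lemma lintegral_hardy {p : Pairs N} (hp : p ∈ DirichletRadial N) :
    ∫⁻ x, ENNReal.ofReal (p.1 x ^ 2 / ‖x‖ ^ 2) ≤ ENNReal.ofReal (4 * ‖p.2‖ ^ 2) := by
  obtain ⟨φ, hφ, hae, hlim⟩ := exists_seq_radialTest hp
  -- Written as a liminf so that Fatou's lemma applies.
  have h1 : ∫⁻ x, ENNReal.ofReal (p.1 x ^ 2 / ‖x‖ ^ 2) =
      ∫⁻ x, liminf (fun n => ENNReal.ofReal (φ n x ^ 2 / ‖x‖ ^ 2)) atTop := by
    apply lintegral_congr_ae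
    filter_upwards [hae] with x hx
    exact (ENNReal.tendsto_ofReal ((hx.pow 2).div_const _)).liminf_eq.symm
  rw [h1]
  refine (lintegral_liminf_le fun n => ?_).trans ?_
  · have := (hφ n).smooth.continuous.measurable
    fun_prop
  · rw [← (ENNReal.tendsto_ofReal (hlim.const_mul 4)).liminf_eq]
    exact liminf_le_liminf (Eventually.of_forall fun n => (hφ n).lintegral_hardy)

end Closure

/-! ### Weighted measures with density continuous off the origin. -/

section PotentialMeasure

variable {N : ℕ} {W : ℝ → ℝ}

lemma ae_norm_pos [Fact (3 ≤ N)] : ∀ᵐ x : Rn N, 0 < ‖x‖ := by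
  filter_upwards [compl_mem_ae_iff.2 (measure_singleton (0 : Rn N))] with x hx
  exact norm_pos_iff.2 hx

/-- Nothing is known about W at 0, but the origin is a null set. -/
lemma aemeasurable_comp_norm [Fact (3 ≤ N)] (hW : ContinuousOn W (Ioi 0)) :
    AEMeasurable (fun x : Rn N => W ‖x‖) := by
  have h : ContinuousOn (fun x : Rn N => W ‖x‖) {0}ᶜ :=
    hW.comp continuous_norm.continuousOn fun x hx => norm_pos_iff.2 hx
  have h2 := h.aemeasurable (μ := volume) (measurableSet_singleton _).compl
  rwa [restrict_compl_singleton] at h2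

lemma integrable_potentialMeasure_iff [Fact (3 ≤ N)] (hW : ContinuousOn W (Ioi 0))
    (h0 : ∀ r > 0, 0 ≤ W r) {F : Rn N → ℝ} :
    Integrable F (potentialMeasure N W) ↔ Integrable (fun x => W ‖x‖ * F x) := by
  unfold potentialMeasure
  rw [integrable_withDensity_iff_integrable_smul₀'
    (aemeasurable_comp_norm hW).ennreal_ofReal (by simp)]
  apply integrable_congr
  filter_upwards [ae_norm_pos] with x hx
  rw [ENNReal.toReal_ofReal (h0 _ hx), smul_eq_mul]

lemma integral_potentialMeasure [Fact (3 ≤ N)] (hW : ContinuousOn W (Ioi 0))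
    (h0 : ∀ r > 0, 0 ≤ W r) (F : Rn N → ℝ) :
    ∫ x, F x ∂(potentialMeasure N W) = ∫ x, W ‖x‖ * F x := by
  unfold potentialMeasure
  rw [integral_withDensity_eq_integral_toReal_smul₀
    (aemeasurable_comp_norm hW).ennreal_ofReal (by simp)]
  apply integral_congr_ae
  filter_upwards [ae_norm_pos] with x hx
  rw [ENNReal.toReal_ofReal (h0 _ hx), smul_eq_mul]

/-- No measurability of F is needed, because the density is finite. -/
lemma setLIntegral_potentialMeasure [Fact (3 ≤ N)] (hW : ContinuousOn W (Ioi 0))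
    (h0 : ∀ r > 0, 0 ≤ W r) (F : Rn N → ℝ) {s : Set (Rn N)} (hs : MeasurableSet s) :
    ∫⁻ x in s, ENNReal.ofReal (F x) ∂(potentialMeasure N W) =
      ∫⁻ x in s, ENNReal.ofReal (W ‖x‖ * F x) := by
  unfold potentialMeasure
  rw [restrict_withDensity hs, lintegral_withDensity_eq_lintegral_mul_non_measurable₀ _
    (aemeasurable_comp_norm hW).ennreal_ofReal.restrict (by simp)]
  apply lintegral_congr_ae
  filter_upwards [ae_restrict_of_ae ae_norm_pos] with x hx
  rw [ENNReal.ofReal_mul (h0 _ hx), Pi.mul_apply]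

end PotentialMeasure

/-! ### Embeddings of E into weighted Lebesgue spaces. -/

namespace E

variable {N : ℕ} [Fact (3 ≤ N)] {V : ℝ → ℝ} {μ : Measure (Rn N)} {q : ℝ}

lemma coeFn_add (u v : E N V) : ((u + v : E N V) : Rn N → ℝ) =ᵐ[volume] fun x => u x + v x := by
  filter_upwards [Lp.coeFn_add u.toPair.1 v.toPair.1] with x hx
  rw [toPair_add, Prod.fst_add, hx, Pi.add_apply]

lemma coeFn_smul (c : ℝ) (u : E N V) :
    ((c • u : E N V) : Rn N → ℝ) =ᵐ[volume] fun x => c * u x := by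
  filter_upwards [Lp.coeFn_smul c u.toPair.1] with x hx
  rw [toPair_smul, Prod.smul_fst, hx, Pi.smul_apply, smul_eq_mul]

lemma norm_toPair_snd_le (u : E N V) : ‖u.toPair.2‖ ≤ ‖u‖ := by
  rw [norm_def]
  linarith [orliczNorm_nonneg (V := V) (u : Rn N → ℝ)]

/-- The gradient as a continuous linear map from `E` to `L²`. -/
noncomputable def gradCLM : E N V →L[ℝ] Lp (Rn N) 2 (volume : Measure (Rn N)) :=
  LinearMap.mkContinuous
    { toFun := fun u => u.toPair.2
      map_add' := fun _ _ => rfl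
      map_smul' := fun _ _ => rfl } 1 fun u =>
    (norm_toPair_snd_le u).trans_eq (one_mul _).symm

/-- A bound of `∫ |u|^q dμ` on the unit sphere gives a bound of the norm in `L^q(μ)`. -/
lemma eLpNorm_le_of_sphere (hμ : μ ≪ volume) (hq : 1 < q) {B : ℝ≥0∞}
    (h : ∀ u : E N V, ‖u‖ = 1 → ∫⁻ x, ENNReal.ofReal (|u x| ^ q) ∂μ ≤ B) (u : E N V) :
    eLpNorm u (ENNReal.ofReal q) μ ≤ ENNReal.ofReal ‖u‖ * B ^ (1 / q) := by
  have hq0 : 0 < q := by linarith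
  have hq0' : ENNReal.ofReal q ≠ 0 := by simpa using hq0
  have hsph : ∀ v : E N V, ‖v‖ = 1 → eLpNorm v (ENNReal.ofReal q) μ ≤ B ^ (1 / q) := by
    intro v hv
    rw [eLpNorm_eq_lintegral_rpow_enorm_toReal hq0' ENNReal.ofReal_ne_top,
      ENNReal.toReal_ofReal hq0.le]
    refine ENNReal.rpow_le_rpow (le_trans (le_of_eq ?_) (h v hv)) (by positivity)
    refine lintegral_congr fun x => ?_
    rw [Real.enorm_eq_ofReal_abs, ENNReal.ofReal_rpow_of_nonneg (abs_nonneg _) hq0.le]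
  rcases eq_or_ne u 0 with rfl | hu
  · have h0 : ((0 : E N V) : Rn N → ℝ) =ᵐ[μ] fun _ => (0 : ℝ) := hμ.ae_eq (Lp.coeFn_zero _ _ _)
    rw [eLpNorm_congr_ae h0]
    simp
  · have hn : 0 < ‖u‖ := norm_pos_iff.2 hu
    have hv : ‖(‖u‖⁻¹ • u : E N V)‖ = 1 := by
      rw [norm_smul, norm_inv, norm_norm, inv_mul_cancel₀ hn.ne']
    have hae : (u : Rn N → ℝ) =ᵐ[μ] ‖u‖ • ((‖u‖⁻¹ • u : E N V) : Rn N → ℝ) := by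
      refine hμ.ae_eq ?_
      filter_upwards [coeFn_smul ‖u‖⁻¹ u] with x hx
      rw [Pi.smul_apply, hx, smul_eq_mul, mul_inv_cancel_left₀ hn.ne']
    rw [eLpNorm_congr_ae hae, eLpNorm_const_smul, Real.enorm_eq_ofReal_abs, abs_norm]
    gcongr
    exact hsph _ hv

/-- A bound of `∫ |u|^q dμ` on the unit sphere gives a continuous embedding into `L^q(μ)`. -/
lemma exists_toLp (hμ : μ ≪ volume) (hq : 1 < q) [Fact (1 ≤ ENNReal.ofReal q)]
    {B : ℝ≥0∞} (hB : B < ⊤)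
    (h : ∀ u : E N V, ‖u‖ = 1 → ∫⁻ x, ENNReal.ofReal (|u x| ^ q) ∂μ ≤ B) :
    ∃ T : E N V →L[ℝ] Lp ℝ (ENNReal.ofReal q) μ, ∀ u : E N V, T u =ᵐ[μ] u := by
  have hBq : B ^ (1 / q) ≠ ⊤ := ENNReal.rpow_ne_top_of_nonneg (by positivity) hB.ne
  -- Elements of E are classes modulo Lebesgue null sets; `μ ≪ volume` turns them into classes
  -- modulo μ.
  have hm : ∀ u : E N V, MemLp u (ENNReal.ofReal q) μ := fun u =>
    ⟨(Lp.aestronglyMeasurable u.toPair.1).mono_ac hμ, (eLpNorm_le_of_sphere hμ hq h u).trans_lt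
      (ENNReal.mul_lt_top ENNReal.ofReal_lt_top hBq.lt_top)⟩
  refine ⟨LinearMap.mkContinuous
    { toFun := fun u => (hm u).toLp _
      map_add' := fun u v => ?_
      map_smul' := fun c u => ?_ } (B ^ (1 / q)).toReal fun u => ?_, fun u => (hm u).coeFn_toLp⟩
  · rw [← MemLp.toLp_add]
    exact MemLp.toLp_congr _ _ (hμ.ae_eq (coeFn_add u v))
  · rw [RingHom.id_apply, ← MemLp.toLp_const_smul]
    exact MemLp.toLp_congr _ _ (hμ.ae_eq (coeFn_smul c u))
  · have h1 := ENNReal.toReal_mono (ENNReal.mul_ne_top ENNReal.ofReal_ne_top hBq)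
      (eLpNorm_le_of_sphere hμ hq h u)
    rw [ENNReal.toReal_mul, ENNReal.toReal_ofReal (norm_nonneg _), mul_comm] at h1
    simpa [Lp.norm_toLp] using h1

/-- Integral functionals with integrand of growth `|t|^q` on `E`. -/
theorem exists_hasFDerivAt_integral (hμ : μ ≪ volume) (hq : 1 < q) {B : ℝ≥0∞} (hB : B < ⊤)
    (h : ∀ u : E N V, ‖u‖ = 1 → ∫⁻ x, ENNReal.ofReal (|u x| ^ q) ∂μ ≤ B) {φ Φ : ℝ → ℝ} {C : ℝ}
    (hC : 0 ≤ C) (hφ : Continuous φ) (hΦ : ∀ t, HasDerivAt Φ (φ t) t) (hΦ0 : Φ 0 = 0)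
    (hb : ∀ t, |φ t| ≤ C * |t| ^ (q - 1)) :
    (∀ u : E N V, Integrable (fun x => Φ (u x)) μ) ∧
    (∀ u v : E N V, Integrable (fun x => φ (u x) * v x) μ) ∧
    ∃ L : E N V → (E N V →L[ℝ] ℝ), Continuous L ∧
      (∀ u, HasFDerivAt (fun v : E N V => ∫ x, Φ (v x) ∂μ) (L u) u) ∧
      ∀ u v, L u v = ∫ x, φ (u x) * v x ∂μ := by
  have hqq : q.HolderConjugate q.conjExponent := Real.HolderConjugate.conjExponent hq
  have : Fact (1 ≤ ENNReal.ofReal q) := ⟨by simpa using hq.le⟩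
  have := hqq.symm.ennrealOfReal
  obtain ⟨T, hT⟩ := exists_toLp hμ hq hB h
  obtain ⟨L, hLc, hL, hLeq⟩ := exists_hasFDerivAt_integral_comp (μ := μ) hqq hC hφ hΦ hΦ0 hb
  have hTm : ∀ u : E N V, MemLp u (ENNReal.ofReal q) μ := fun u =>
    (memLp_congr_ae (hT u)).1 (Lp.memLp (T u))
  refine ⟨fun u => integrable_comp_of_growth hqq hC hΦ hΦ0 hb (hTm u),
    fun u v => (memLp_deriv_comp hqq hφ hb (hTm u)).integrable_mul (hTm v),
    fun u => (L (T u)).comp T, ?_, fun u => ?_, fun u v => ?_⟩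
  · exact (hLc.comp T.continuous).clm_comp continuous_const
  · have h1 := (hL (T u)).comp u T.hasFDerivAt
    refine h1.congr_of_eventuallyEq (Eventually.of_forall fun v => ?_)
    apply integral_congr_ae
    filter_upwards [hT v] with x hx
    rw [hx]
  · rw [ContinuousLinearMap.comp_apply, hLeq]
    apply integral_congr_ae
    filter_upwards [hT u, hT v] with x hx hx'
    rw [hx, hx']

end E

/-! ### Growth of f, f² and G∘f. -/

lemma deriv_chg (t : ℝ) : deriv chg t = 1 / Real.sqrt (1 + 2 * chg t ^ 2) :=
  (chg_hasDerivAt t).deriv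

lemma continuous_deriv_chg : Continuous (deriv chg) := by
  have h : deriv chg = fun t => 1 / Real.sqrt (1 + 2 * chg t ^ 2) := funext deriv_chg
  rw [h]
  have := chg_continuous
  exact continuous_const.div (by fun_prop) fun t => (sqrt_weight_pos _).ne'

lemma deriv_chg_pos (t : ℝ) : 0 < deriv chg t := by
  rw [deriv_chg]
  exact one_div_pos.2 (sqrt_weight_pos _)

lemma deriv_chg_le_one (t : ℝ) : deriv chg t ≤ 1 := by
  rw [deriv_chg, div_le_one (sqrt_weight_pos _)]
  exact Real.one_le_sqrt.2 (by nlinarith [sq_nonneg (chg t)])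

lemma abs_chg_le (t : ℝ) : |chg t| ≤ |t| := by
  have h := convex_univ.norm_image_sub_le_of_norm_deriv_le (f := chg) (C := 1) (x := 0) (y := t)
    (fun s _ => (chg_hasDerivAt s).differentiableAt)
    (fun s _ => by rw [Real.norm_of_nonneg (deriv_chg_pos s).le]; exact deriv_chg_le_one s)
    (mem_univ _) (mem_univ _)
  simpa [chg_zero] using h

/-- Near the origin `f(t)²` is comparable to `t²`. -/
lemma sq_le_chg_sq (t : ℝ) : t ^ 2 ≤ (1 + 2 * t ^ 2) * chg t ^ 2 := by
  wlog ht : 0 ≤ t generalizing t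
  · have := this (-t) (by linarith)
    rwa [chg_neg, neg_sq, neg_sq] at this
  have hw := sqrt_weight_pos t
  -- On [0, t] one has f(s)² ≤ t², hence f' ≥ 1/√(1 + 2t²), which integrates to a lower bound for
  -- f(t).
  have h := (convex_Icc 0 t).mul_sub_le_image_sub_of_le_deriv (f := chg)
    (C := 1 / Real.sqrt (1 + 2 * t ^ 2)) chg_continuous.continuousOn
    (fun s _ => (chg_hasDerivAt s).differentiableAt.differentiableWithinAt)
    (fun s hs => by
      rw [interior_Icc] at hs
      rw [deriv_chg]
      refine one_div_le_one_div_of_le (sqrt_weight_pos _) (Real.sqrt_le_sqrt ?_)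
      have h1 : chg s ^ 2 ≤ t ^ 2 :=
        sq_le_sq.2 ((abs_chg_le s).trans (abs_le_abs_of_nonneg hs.1.le hs.2.le))
      linarith) 0 (left_mem_Icc.2 ht) t (right_mem_Icc.2 ht) ht
  rw [chg_zero, sub_zero, sub_zero, one_div_mul_eq_div, div_le_iff₀ hw] at h
  have h1 := pow_le_pow_left₀ ht h 2
  rw [mul_pow, Real.sq_sqrt (by positivity)] at h1
  linarith

lemma hasDerivAt_chg_sq (t : ℝ) :
    HasDerivAt (fun t => chg t ^ 2) (2 * (chg t * deriv chg t)) t := by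
  have h : HasDerivAt (fun t => chg t ^ 2) _ t := (chg_hasDerivAt t).pow 2
  refine h.congr_deriv ?_
  rw [deriv_chg]
  push_cast
  ring

/-- The case p = 2 of the growth condition, from |f(t)| ≤ |t| and 0 < f' ≤ 1; the exponent keeps the
form p - 1. -/
lemma abs_deriv_chg_sq_le (t : ℝ) : |2 * (chg t * deriv chg t)| ≤ 2 * |t| ^ ((2 : ℝ) - 1) := by
  rw [show (2 : ℝ) - 1 = 1 by norm_num, Real.rpow_one, abs_mul, abs_mul, abs_two,
    abs_of_pos (deriv_chg_pos t)]
  have := mul_le_mul (abs_chg_le t) (deriv_chg_le_one t) (deriv_chg_pos t).le (abs_nonneg t)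
  linarith

section Primitive

variable {g : ℝ → ℝ}

lemma hasDerivAt_primitive_chg (hg : Continuous g) (t : ℝ) :
    HasDerivAt (fun t => primitive g (chg t)) (g (chg t) * deriv chg t) t := by
  have h1 : HasDerivAt (primitive g) (g (chg t)) (chg t) :=
    (hg.integral_hasStrictDerivAt 0 (chg t)).hasDerivAt
  rw [deriv_chg]
  exact h1.comp t (chg_hasDerivAt t)

/-- The same two bounds on f and f' show that the change of variable preserves any power growth of
g. -/
lemma abs_deriv_primitive_chg_le {C q : ℝ} (hC : 0 ≤ C) (hq : 1 < q)
    (hb : ∀ t, |g t| ≤ C * |t| ^ (q - 1)) (t : ℝ) :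
    |g (chg t) * deriv chg t| ≤ C * |t| ^ (q - 1) := by
  have hq' : 0 ≤ q - 1 := by linarith
  rw [abs_mul, abs_of_pos (deriv_chg_pos t)]
  calc |g (chg t)| * deriv chg t ≤ |g (chg t)| * 1 := by gcongr; exact deriv_chg_le_one t
    _ ≤ C * |chg t| ^ (q - 1) := by rw [mul_one]; exact hb _
    _ ≤ C * |t| ^ (q - 1) := 
        mul_le_mul_of_nonneg_left (Real.rpow_le_rpow (abs_nonneg _) (abs_chg_le t) hq') hC

end Primitive

/-! ### The three terms of the functional on E. -/

namespace E

variable {N : ℕ} [Fact (3 ≤ N)] {V K : ℝ → ℝ}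

/-- The modular `∫ V(|x|) f(u)² dx` is bounded on the unit sphere of `E`. -/
lemma integral_chg_sq_le {u : E N V} (hu : ‖u‖ = 1) :
    ∫ x, chg (u x) ^ 2 ∂(potentialMeasure N V) ≤ 4 := by
  have hmu := Lp.aestronglyMeasurable u.toPair.1
  -- Halving u makes the infimum strictly less than 1, so some k has (1 + ∫ V f(ku/2)²)/k < 1. This
  -- gives both k ≥ 1 and ∫ V f(ku/2)² < k.
  have hlt : orliczNorm V (fun x => 2⁻¹ * u x) < 1 := by
    rw [orliczNorm_smul, abs_of_pos (by norm_num)]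
    have h := norm_def u
    rw [hu] at h
    linarith [norm_nonneg u.toPair.2]
  obtain ⟨⟨k, hk⟩, hk1⟩ := exists_lt_of_ciInf_lt hlt
  have hk0 : 0 < k := hk
  simp only at hk1
  have hint := integrable_chg_mul hmu u.integrable_chg
  have hint' : Integrable (fun x => chg (k * (2⁻¹ * u x)) ^ 2) (potentialMeasure N V) := by
    simpa only [mul_assoc] using hint (k * 2⁻¹)
  have hnn : 0 ≤ ∫ x, chg (k * (2⁻¹ * u x)) ^ 2 ∂(potentialMeasure N V) :=
    integral_nonneg fun x => sq_nonneg _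
  rw [one_div_mul_eq_div, div_lt_one hk0] at hk1
  have hk2 : 1 ≤ k := by linarith
  -- Doubling costs the factor 4, and convexity with f(0) = 0 gains 1/k, which cancels the bound k
  -- on the modular.
  have hpt : ∀ x, chg (u x) ^ 2 ≤ 4 * (k⁻¹ * chg (k * (2⁻¹ * u x)) ^ 2) := fun x => by
    have h1 := chg_sq_two_mul (2⁻¹ * u x)
    rw [mul_inv_cancel_left₀ two_ne_zero] at h1
    have h2 := chg_sq_convex k⁻¹ (1 - k⁻¹) (k * (2⁻¹ * u x)) 0 (by positivity)
      (sub_nonneg.2 (inv_le_one_of_one_le₀ hk2)) (by ring)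
    rw [inv_mul_cancel_left₀ hk0.ne', mul_zero, add_zero, chg_zero] at h2
    linarith
  have h := integral_mono u.integrable_chg ((hint'.const_mul k⁻¹).const_mul 4) hpt
  rw [integral_const_mul, integral_const_mul, inv_mul_eq_div] at h
  have h3 : (∫ x, chg (k * (2⁻¹ * u x)) ^ 2 ∂(potentialMeasure N V)) / k ≤ 1 :=
    (div_le_one hk0).2 (by linarith)
  linarith

/-- `E` is bounded in `L²(V(|x|) dx)`. -/
lemma exists_lintegral_sq_le (hVK : HypH V K) :
    ∃ B : ℝ≥0∞, B < ⊤ ∧ ∀ u : E N V, ‖u‖ = 1 →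
      ∫⁻ x, ENNReal.ofReal (|u x| ^ (2 : ℝ)) ∂(potentialMeasure N V) ≤ B := by
  obtain ⟨C, hC, hV⟩ := hVK.V_le
  obtain ⟨M, hM, hbd⟩ := exists_ae_bound N one_pos
  have hac : potentialMeasure N V ≪ volume := withDensity_absolutelyContinuous _ _
  -- First summand: V ≤ C/|x|² in the unit ball and Hardy's inequality with ‖∇u‖ ≤ 1. Second
  -- summand: outside it |u| ≤ M, so u² ≤ (1 + 2M²) f(u)², and the modular is at most 4.
  refine ⟨ENNReal.ofReal C * ENNReal.ofReal (4 * 1 ^ 2) +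
    ENNReal.ofReal (1 + 2 * M ^ 2) * ENNReal.ofReal 4, by
      simp only [← ENNReal.ofReal_mul hC.le, ← ENNReal.ofReal_mul (by positivity :
        0 ≤ 1 + 2 * M ^ 2)]
      exact ENNReal.add_lt_top.2 ⟨ENNReal.ofReal_lt_top, ENNReal.ofReal_lt_top⟩,
    fun u hu => ?_⟩
  have hu1 : ‖u.toPair.2‖ ≤ 1 := hu ▸ norm_toPair_snd_le u
  have hfar : ∫⁻ x, ENNReal.ofReal (V ‖x‖ * chg (u x) ^ 2) ≤ ENNReal.ofReal 4 := by
    have h := setLIntegral_potentialMeasure hVK.continuousOn_V hVK.V_nonneg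
      (fun x : Rn N => chg (u x) ^ 2) MeasurableSet.univ
    rw [Measure.restrict_univ, Measure.restrict_univ] at h
    rw [← h, ← ofReal_integral_eq_lintegral_ofReal u.integrable_chg
      (Eventually.of_forall fun x => sq_nonneg _)]
    exact ENNReal.ofReal_le_ofReal (integral_chg_sq_le hu)
  have hnear : ∫⁻ x, ENNReal.ofReal (u x ^ 2 / ‖x‖ ^ 2) ≤ ENNReal.ofReal (4 * 1 ^ 2) :=
    (lintegral_hardy u.toPair_mem).trans (ENNReal.ofReal_le_ofReal (by gcongr))
  have h := setLIntegral_potentialMeasure hVK.continuousOn_V hVK.V_nonneg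
    (fun x : Rn N => |u x| ^ (2 : ℝ)) MeasurableSet.univ
  rw [Measure.restrict_univ, Measure.restrict_univ] at h
  rw [h]
  calc ∫⁻ x, ENNReal.ofReal (V ‖x‖ * |u x| ^ (2 : ℝ))
      ≤ ∫⁻ x, (ENNReal.ofReal C * ENNReal.ofReal (u x ^ 2 / ‖x‖ ^ 2) +
          ENNReal.ofReal (1 + 2 * M ^ 2) * ENNReal.ofReal (V ‖x‖ * chg (u x) ^ 2)) := by
        apply lintegral_mono_ae
        filter_upwards [ae_norm_pos, hbd _ u.toPair_mem hu1] with x hx hxM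
        rw [Real.rpow_two, sq_abs, ← ENNReal.ofReal_mul hC.le,
          ← ENNReal.ofReal_mul (by positivity)]
        rcases lt_or_ge ‖x‖ 1 with h1 | h1
        · refine le_trans (ENNReal.ofReal_le_ofReal ?_) le_self_add
          calc V ‖x‖ * u x ^ 2 ≤ C / ‖x‖ ^ 2 * u x ^ 2 := by
                gcongr
                exact hV _ ⟨hx, h1⟩
            _ = C * (u x ^ 2 / ‖x‖ ^ 2) := by ring
        · refine le_trans (ENNReal.ofReal_le_ofReal ?_) le_add_self
          have h2 : u x ^ 2 ≤ M ^ 2 := sq_le_sq.2 ((hxM h1).trans (le_abs_self M))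
          have hV0 := hVK.V_nonneg _ hx
          calc V ‖x‖ * u x ^ 2 ≤ V ‖x‖ * ((1 + 2 * u x ^ 2) * chg (u x) ^ 2) := by
                gcongr
                exact sq_le_chg_sq _
            _ ≤ V ‖x‖ * ((1 + 2 * M ^ 2) * chg (u x) ^ 2) := by gcongr
            _ = (1 + 2 * M ^ 2) * (V ‖x‖ * chg (u x) ^ 2) := by ring
    _ ≤ _ := by
        have hum := (Lp.aestronglyMeasurable u.toPair.1).aemeasurable
        have hm1 : AEMeasurable (fun x : Rn N => ENNReal.ofReal (u x ^ 2 / ‖x‖ ^ 2)) := by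
          have : AEMeasurable (fun x : Rn N => ‖x‖ ^ 2) := by fun_prop
          exact ((hum.pow_const 2).div this).ennreal_ofReal
        rw [lintegral_add_left' (hm1.const_mul _), lintegral_const_mul' _ _ ENNReal.ofReal_ne_top,
          lintegral_const_mul' _ _ ENNReal.ofReal_ne_top]
        gcongr

/-- The radius in the condition near the origin can be enlarged. -/
lemma exists_setLIntegral_ball_le (hVK : HypH V K) {q R₁ : ℝ} (hq : 1 < q) (hR₁ : 0 < R₁)
    (R₂ : ℝ) (hS : S₀ N V K q R₁ < ⊤) :
    ∃ B : ℝ≥0∞, B < ⊤ ∧ ∀ u : E N V, ‖u‖ = 1 →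
      ∫⁻ x in Metric.ball (0 : Rn N) R₂, ENNReal.ofReal (K ‖x‖ * |u x| ^ q) ≤ B := by
  obtain ⟨M, hM, hbd⟩ := exists_ae_bound N hR₁
  -- K is bounded on the compact interval [R₁, R₂] of (0, ∞); for R₂ < R₁ this interval and the
  -- annulus A are empty.
  obtain ⟨k, hk⟩ := (isCompact_Icc (a := R₁) (b := R₂)).exists_bound_of_continuousOn
    (hVK.continuousOn_K.mono fun r hr => hR₁.trans_le hr.1)
  refine ⟨S₀ N V K q R₁ + ENNReal.ofReal (k * M ^ q) * volume (Metric.ball (0 : Rn N) R₂),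
    ENNReal.add_lt_top.2 ⟨hS, ENNReal.mul_lt_top ENNReal.ofReal_lt_top measure_ball_lt_top⟩,
    fun u hu => ?_⟩
  have hu1 : ‖u.toPair.2‖ ≤ 1 := hu ▸ norm_toPair_snd_le u
  set A : Set (Rn N) := Metric.ball 0 R₂ \ Metric.ball 0 R₁ with hA
  have hsub : Metric.ball (0 : Rn N) R₂ ⊆ Metric.ball 0 R₁ ∪ A := by
    rw [hA, union_sdiff_self]
    exact subset_union_right
  refine (lintegral_mono_set hsub).trans ((lintegral_union_le _ _ _).trans ?_)
  gcongr
  · exact le_iSup₂ (f := fun (u : E N V) (_ : ‖u‖ = 1) =>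
      ∫⁻ x in Metric.ball (0 : Rn N) R₁, ENNReal.ofReal (K ‖x‖ * |u x| ^ q)) u hu
  · calc ∫⁻ x in A, ENNReal.ofReal (K ‖x‖ * |u x| ^ q)
        ≤ ∫⁻ _ in A, ENNReal.ofReal (k * M ^ q) := by
          refine lintegral_mono_ae ((ae_restrict_iff'
            (measurableSet_ball.diff measurableSet_ball)).2 ?_)
          filter_upwards [hbd _ u.toPair_mem hu1] with x hx hxA
          rw [Set.mem_sdiff, mem_ball_zero_iff, mem_ball_zero_iff, not_lt] at hxA
          have h1 := (le_abs_self _).trans (hk ‖x‖ ⟨hxA.2, hxA.1.le⟩)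
          have h2 := hx hxA.2
          have h3 := hVK.K_pos _ (hR₁.trans_le hxA.2)
          gcongr
          exact h3.le.trans h1
      _ ≤ ENNReal.ofReal (k * M ^ q) * volume (Metric.ball (0 : Rn N) R₂) := by
          rw [setLIntegral_const]
          gcongr
          exact sdiff_subset

variable {g : ℝ → ℝ} {q₁ q₂ : ℝ}

/-- The potential term of the functional. -/
lemma exists_hasFDerivAt_potential (hVK : HypH V K) :
    (∀ u : E N V, Integrable (fun x => V ‖x‖ * chg (u x) ^ 2)) ∧
    (∀ u h : E N V, Integrable (fun x => V ‖x‖ * (chg (u x) * deriv chg (u x) * h x))) ∧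
    ∃ L : E N V → (E N V →L[ℝ] ℝ), Continuous L ∧
      (∀ u, HasFDerivAt (fun v : E N V => 1 / 2 * ∫ x, V ‖x‖ * chg (v x) ^ 2) (L u) u) ∧
      ∀ u h, L u h = ∫ x, V ‖x‖ * (chg (u x) * deriv chg (u x) * h x) := by
  obtain ⟨B, hB, hbd⟩ := exists_lintegral_sq_le (N := N) hVK
  have hcont : Continuous fun t => 2 * (chg t * deriv chg t) :=
    continuous_const.mul (chg_continuous.mul continuous_deriv_chg)
  obtain ⟨hI, hI', L, hLc, hL, hLeq⟩ := exists_hasFDerivAt_integral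
    (withDensity_absolutelyContinuous _ _) one_lt_two hB hbd zero_le_two hcont
    hasDerivAt_chg_sq (by simp [chg_zero]) abs_deriv_chg_sq_le
  -- The factor 2 in (f²)' = 2ff' cancels the ½ of the functional.
  have hhalf : ∀ u h : E N V, (fun x => chg (u x) * deriv chg (u x) * h x) =
      fun x => 2⁻¹ * (2 * (chg (u x) * deriv chg (u x)) * h x) := fun u h => by
    funext x
    ring
  simp only [← integral_potentialMeasure hVK.continuousOn_V hVK.V_nonneg,
    ← integrable_potentialMeasure_iff hVK.continuousOn_V hVK.V_nonneg]
  refine ⟨hI, fun u h => ?_, fun u => (1 / 2 : ℝ) • L u, hLc.const_smul (1 / 2 : ℝ),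
    fun u => (hL u).const_mul _, fun u h => ?_⟩
  · rw [hhalf]
    exact (hI' u h).const_mul _
  · rw [hhalf, integral_const_mul, smul_apply, hLeq, smul_eq_mul, one_div]
    rfl

/-- The nonlinear term of the functional. -/
lemma exists_hasFDerivAt_nonlinearity (hq₁ : 1 < q₁) (hq₂ : 1 < q₂) (hVK : HypH V K)
    (hg : Continuous g) (hgq : HypGrowth g q₁ q₂) (hS : CondS N V K q₁ q₂) :
    (∀ u : E N V, Integrable (fun x => K ‖x‖ * primitive g (chg (u x)))) ∧
    (∀ u h : E N V, Integrable (fun x => K ‖x‖ * (g (chg (u x)) * deriv chg (u x) * h x))) ∧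
    ∃ L : E N V → (E N V →L[ℝ] ℝ), Continuous L ∧
      (∀ u, HasFDerivAt (fun v : E N V => ∫ x, K ‖x‖ * primitive g (chg (v x))) (L u) u) ∧
      ∀ u h, L u h = ∫ x, K ‖x‖ * (g (chg (u x)) * deriv chg (u x) * h x) := by
  have hK0 : ∀ r > 0, 0 ≤ K r := fun r hr => (hVK.K_pos r hr).le
  obtain ⟨C, hC, hgb⟩ := hgq
  obtain ⟨R₁, hR₁, R₂, -, hS₁, hS₂⟩ := hS
  -- Cutting at the single radius R₂ makes the two regions complementary: on s the growth exponent
  -- is q₁, on its complement q₂.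
  set s : Set (Rn N) := Metric.ball 0 R₂ with hs
  have hsm : MeasurableSet s := measurableSet_ball
  have hac : ∀ t : Set (Rn N), (potentialMeasure N K).restrict t ≪ volume := fun t =>
    Measure.restrict_le_self.absolutelyContinuous.trans (withDensity_absolutelyContinuous _ _)
  have hcont : Continuous fun t => g (chg t) * deriv chg t :=
    (hg.comp chg_continuous).mul continuous_deriv_chg
  have h0 : primitive g (chg 0) = 0 := by
    rw [chg_zero, primitive, intervalIntegral.integral_same]
  obtain ⟨B, hB, hbd⟩ := exists_setLIntegral_ball_le hVK hq₁ hR₁ R₂ hS₁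
  obtain ⟨hI₁, hI₁', L₁, hLc₁, hL₁, hLeq₁⟩ := exists_hasFDerivAt_integral (N := N) (V := V)
    (hac s) hq₁ hB
    (fun u hu => by
      rw [setLIntegral_potentialMeasure hVK.continuousOn_K hK0 _ hsm]
      exact hbd u hu)
    hC.le hcont (hasDerivAt_primitive_chg hg) h0
    (abs_deriv_primitive_chg_le hC.le hq₁ fun t => (hgb t).trans (by gcongr; exact min_le_left _ _))
  obtain ⟨hI₂, hI₂', L₂, hLc₂, hL₂, hLeq₂⟩ := exists_hasFDerivAt_integral (N := N) (V := V)
    (hac sᶜ) hq₂ hS₂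
    (fun u hu => by
      rw [setLIntegral_potentialMeasure hVK.continuousOn_K hK0 _ hsm.compl]
      exact le_iSup₂ (f := fun (u : E N V) (_ : ‖u‖ = 1) =>
        ∫⁻ x in (Metric.ball (0 : Rn N) R₂)ᶜ, ENNReal.ofReal (K ‖x‖ * |u x| ^ q₂)) u hu)
    hC.le hcont (hasDerivAt_primitive_chg hg) h0
    (abs_deriv_primitive_chg_le hC.le hq₂ fun t => (hgb t).trans (by gcongr; exact min_le_right _ _))
  have hglue : ∀ {F : Rn N → ℝ}, Integrable F ((potentialMeasure N K).restrict s) →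
      Integrable F ((potentialMeasure N K).restrict sᶜ) →
      Integrable F (potentialMeasure N K) := fun h₁ h₂ => by
    rw [← integrableOn_univ, ← union_compl_self s]
    exact IntegrableOn.union h₁ h₂
  simp only [← integral_potentialMeasure hVK.continuousOn_K hK0,
    ← integrable_potentialMeasure_iff hVK.continuousOn_K hK0]
  have hint := fun u : E N V => hglue (hI₁ u) (hI₂ u)
  have hint' := fun u h : E N V => hglue (hI₁' u h) (hI₂' u h)
  refine ⟨hint, hint', fun u => L₁ u + L₂ u, hLc₁.add hLc₂, fun u => ?_, fun u h => ?_⟩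
  · refine ((hL₁ u).add (hL₂ u)).congr_of_eventuallyEq (Eventually.of_forall fun v => ?_)
    exact (integral_add_compl hsm (hint v)).symm
  · rw [add_apply, hLeq₁, hLeq₂]
    exact integral_add_compl hsm (hint' u h)

/-- The gradient term of the functional. -/
lemma hasFDerivAt_gradient (u : E N V) :
    HasFDerivAt (fun v : E N V => 1 / 2 * ∫ x, ‖v.grad x‖ ^ 2)
      ((innerSL ℝ (gradCLM u)).comp gradCLM) u := by
  have h := (((hasStrictFDerivAt_norm_sq (gradCLM u)).hasFDerivAt).comp u
    (gradCLM (N := N) (V := V)).hasFDerivAt).const_mul (1 / 2 : ℝ)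
  refine (h.congr_of_eventuallyEq (Eventually.of_forall fun v => ?_)).congr_fderiv ?_
  · exact congrArg (1 / 2 * ·) (integral_norm_sq_eq v.toPair.2)
  · ext v
    simp

end E

end OrliczSobolev

/-! ### Assembling the differential. -/

theorem theorem6p1 (N : ℕ) [Fact (3 ≤ N)] (V K g : ℝ → ℝ) (q₁ q₂ : ℝ)
    (hq₁ : 1 < q₁) (hq₂ : 1 < q₂)
    (hVK : OrliczSobolev.HypH V K)
    (hg : Continuous g)
    (hg1 : OrliczSobolev.HypG1 g)
    (hg2 : OrliczSobolev.HypG2 g)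
    (hgq : OrliczSobolev.HypGrowth g q₁ q₂)
    (hS : OrliczSobolev.CondS N V K q₁ q₂) :
    -- the functional is well defined: its three integrals are finite
    (∀ u : OrliczSobolev.E N V,
      Integrable (fun x => ‖u.grad x‖ ^ 2) ∧
      Integrable (fun x => V ‖x‖ * OrliczSobolev.chg (u x) ^ 2) ∧
      Integrable (fun x => K ‖x‖ *
        OrliczSobolev.primitive g (OrliczSobolev.chg (u x)))) ∧
    Continuous (OrliczSobolev.functional N V K g) ∧
    ContDiff ℝ 1 (OrliczSobolev.functional N V K g) ∧
    ∀ u h : OrliczSobolev.E N V,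
      Integrable (fun x => (inner ℝ (u.grad x) (h.grad x) : ℝ)) ∧
      Integrable (fun x => V ‖x‖ *
        (OrliczSobolev.chg (u x) * deriv OrliczSobolev.chg (u x) * h x)) ∧
      Integrable (fun x => K ‖x‖ *
        (g (OrliczSobolev.chg (u x)) * deriv OrliczSobolev.chg (u x) * h x)) ∧
      fderiv ℝ (OrliczSobolev.functional N V K g) u h =
        (∫ x, (inner ℝ (u.grad x) (h.grad x) : ℝ))
        + (∫ x, V ‖x‖ * (OrliczSobolev.chg (u x) * deriv OrliczSobolev.chg (u x) * h x))
        - ∫ x, K ‖x‖ *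
            (g (OrliczSobolev.chg (u x)) * deriv OrliczSobolev.chg (u x) * h x) := by
  obtain ⟨hV, hV', LV, hLVc, hLV, hLVeq⟩ :=
    OrliczSobolev.E.exists_hasFDerivAt_potential (N := N) hVK
  obtain ⟨hK, hK', LK, hLKc, hLK, hLKeq⟩ :=
    OrliczSobolev.E.exists_hasFDerivAt_nonlinearity hq₁ hq₂ hVK hg hgq hS
  -- The candidate differential. Its continuity in u, together with `hD`, gives both C¹ regularity
  -- and the formula.
  let D : OrliczSobolev.E N V → (OrliczSobolev.E N V →L[ℝ] ℝ) := fun u =>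
    (innerSL ℝ (OrliczSobolev.E.gradCLM u)).comp OrliczSobolev.E.gradCLM + LV u - LK u
  have hD : ∀ u, HasFDerivAt (OrliczSobolev.functional N V K g) (D u) u := fun u =>
    ((OrliczSobolev.E.hasFDerivAt_gradient u).add (hLV u)).sub (hLK u)
  have hDc : Continuous D := by
    refine (Continuous.add ?_ hLVc).sub hLKc
    exact ((innerSL ℝ).continuous.comp OrliczSobolev.E.gradCLM.continuous).clm_comp
      continuous_const
  have hC1 : ContDiff ℝ 1 (OrliczSobolev.functional N V K g) :=
    contDiff_one_iff_hasFDerivAt.2 ⟨D, hDc, hD⟩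
  refine ⟨fun u => ⟨(Lp.memLp u.toPair.2).integrable_norm_pow two_ne_zero, hV u, hK u⟩,
    hC1.continuous, hC1, fun u h => ⟨L2.integrable_inner u.toPair.2 h.toPair.2, hV' u h, hK' u h,
    ?_⟩⟩
  rw [(hD u).fderiv, ← hLVeq, ← hLKeq]
  -- The gradient term of D is the L² inner product of the gradients, which is by definition the
  -- integral in the formula.
  congr 2
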